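/- Let $n\ge 1$, let $m>2$ be a prime, let $\{R_k\}_{k\ge1}\subset M_n(\mathbb Z)$ be expanding matrices (all eigenvalues have modulus $>1$) and let $D_k\subset\mathbb Z^n$ ($k\ge1$) be finite sets with $\#D_k=m$. For finite $E\subset\mathbb R^n$ let $\delta_E=\frac1{\#E}\sum_{a\in E}\delta_a$, and for finite $D\subset\mathbb Z^n$ let $\mathcal Z(m_D)$ be the zero set in $\mathbb R^n$ of $m_D(\xi)=\frac1{\#D}\sum_{d\in D}e^{2\pi i\langle\xi,d\rangle}$. Let $\|\cdot\|$ be the Euclidean norm and $\|A\|'=\sup_{x\ne0}\|Ax\|/\|x\|$. Assume: 1. $\limsup_{k\to\infty}\|R_k^{-1}\|'<1$ and $\sup\{\|d\|: d\in D_k,\ k\ge1\}<\infty$. 2. For every $k\ge1$ there is given $\nu_k\in\{1,\dots,m-1\}^n$ with $$\mathcal Z(m_{D_k})=\bigcup_{j=1}^{m-1}\Big(\frac jm\nu_k+\mathbb Z^n\Big).$$ 3. There are $\delta,\beta\in(0,\frac14)$ and $N\in\mathbb N$ such that for all $k>N$ and $p\ge1$ the matrix $A=R_{k+1}^tR_{k+2}^t\cdots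 R_{k+p}^t$ satisfies $$A^{-1}\Big[-\frac12-\delta,\frac12+\delta\Big]^n\cap\Big\{x\in\mathbb R^n:\ \inf_{y\in Z}\|x-y\|<\beta\Big\}=\emptyset,\qquad Z=\bigcup_{k\ge1}\mathcal Z(m_{D_k}).$$ Then the infinite convolution (Moran measure) $$\mu_{\{R_k\},\{D_k\}}=\delta_{R_1^{-1}D_1}*\delta_{R_1^{-1}R_2^{-1}D_2}*\delta_{R_1^{-1}R_2^{-1}R_3^{-1}D_3}*\cdots$$ exists as the weak limit of the finite convolutions, and it is a spectral measure, that is, a compactly supported Borel probability measure for which there is a countable $\Lambda\subset\mathbb R^n$ such that $\{e^{-2\pi i\langle\lambda,x\rangle}:\lambda\in\Lambda\}$ is an orthonormal basis of $L^2(\mu_{\{R_k\},\{D_k\}})$, if and only if $\frac1m\nu_k^tR_k\in\mathbb Z^n$ for all $k\ge2$. -/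

import Mathlib

open MeasureTheory Filter Topology
open scoped BoundedContinuousFunction ENNReal Matrix

noncomputable section

namespace Moran

/-- An integer vector, seen as a point of Euclidean space. -/
def intVec {n : ℕ} (d : Fin n → ℤ) : EuclideanSpace ℝ (Fin n) :=
  WithLp.toLp 2 fun i => (d i : ℝ)

/-- An integer matrix, seen as a real matrix. -/
def realMat {n : ℕ} (A : Matrix (Fin n) (Fin n) ℤ) : Matrix (Fin n) (Fin n) ℝ :=
  A.map fun a => (a : ℝ)

/-- The linear map `x ↦ A x` on Euclidean space. Its norm is the operator norm
`sup_{x ≠ 0} ‖A x‖ / ‖x‖` for the Euclidean norm. -/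
def euclMap {n : ℕ} (A : Matrix (Fin n) (Fin n) ℝ) :
    EuclideanSpace ℝ (Fin n) →L[ℝ] EuclideanSpace ℝ (Fin n) :=
  Matrix.toEuclideanCLM (n := Fin n) (𝕜 := ℝ) A

/-- An integer matrix is expanding if all its complex eigenvalues have modulus `> 1`. -/
def IsExpanding {n : ℕ} (A : Matrix (Fin n) (Fin n) ℤ) : Prop :=
  ∀ z ∈ spectrum ℂ (A.map fun a => (a : ℂ)), 1 < ‖z‖

/-- `δ_E`, the uniform probability measure on a finite nonempty set `E`. -/
def uniformMeasure {n : ℕ} (E : Finset (EuclideanSpace ℝ (Fin n))) :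
    Measure (EuclideanSpace ℝ (Fin n)) :=
  (E.card : ℝ≥0∞)⁻¹ • ∑ a ∈ E, Measure.dirac a

/-- `R₁⁻¹ R₂⁻¹ ⋯ R_l⁻¹`. (Sequences are indexed by `k ≥ 1`; the entry `0` is never used.) -/
def invProd {n : ℕ} (R : ℕ → Matrix (Fin n) (Fin n) ℤ) : ℕ → Matrix (Fin n) (Fin n) ℝ
  | 0 => 1
  | l + 1 => invProd R l * (realMat (R (l + 1)))⁻¹

open Classical in
/-- The finite set `R₁⁻¹ R₂⁻¹ ⋯ R_k⁻¹ D_k`. -/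
def scaledDigits {n : ℕ} (R : ℕ → Matrix (Fin n) (Fin n) ℤ) (D : ℕ → Finset (Fin n → ℤ))
    (k : ℕ) : Finset (EuclideanSpace ℝ (Fin n)) :=
  (D k).image fun d => euclMap (invProd R k) (intVec d)

/-- The finite convolution `δ_{R₁⁻¹D₁} * δ_{R₁⁻¹R₂⁻¹D₂} * ⋯ * δ_{R₁⁻¹⋯R_l⁻¹D_l}`. -/
def finiteConv {n : ℕ} (R : ℕ → Matrix (Fin n) (Fin n) ℤ) (D : ℕ → Finset (Fin n → ℤ)) :
    ℕ → Measure (EuclideanSpace ℝ (Fin n))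
  | 0 => Measure.dirac 0
  | l + 1 => (finiteConv R D l).conv (uniformMeasure (scaledDigits R D (l + 1)))

/-- `μ` is the Moran measure `δ_{R₁⁻¹D₁} * δ_{R₁⁻¹R₂⁻¹D₂} * ⋯`: the Borel probability measure that
is the weak limit of the finite convolutions. -/
def IsMoranMeasure {n : ℕ} (R : ℕ → Matrix (Fin n) (Fin n) ℤ) (D : ℕ → Finset (Fin n → ℤ))
    (μ : Measure (EuclideanSpace ℝ (Fin n))) : Prop :=
  IsProbabilityMeasure μ ∧
    ∀ f : EuclideanSpace ℝ (Fin n) →ᵇ ℝ,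
      Tendsto (fun l => ∫ x, f x ∂(finiteConv R D l)) atTop (𝓝 (∫ x, f x ∂μ))

/-- `Λ` is a spectrum of `μ`: it is countable and the exponentials `x ↦ e^{-2πi⟨λ,x⟩}`, `λ ∈ Λ`,
form an orthonormal basis of `L²(μ)`. -/
def IsSpectrum {n : ℕ} (μ : Measure (EuclideanSpace ℝ (Fin n)))
    (Λ : Set (EuclideanSpace ℝ (Fin n))) : Prop :=
  Λ.Countable ∧ ∃ b : HilbertBasis Λ ℂ (Lp ℂ 2 μ), ∀ l : Λ,
    (b l : EuclideanSpace ℝ (Fin n) → ℂ) =ᵐ[μ]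
      fun x => Complex.exp (-2 * Real.pi * Complex.I * (inner ℝ (l : EuclideanSpace ℝ (Fin n)) x : ℝ))

/-- A spectral measure: a compactly supported Borel probability measure that has a spectrum. -/
def IsSpectralMeasure {n : ℕ} (μ : Measure (EuclideanSpace ℝ (Fin n))) : Prop :=
  IsProbabilityMeasure μ ∧ (∃ K : Set (EuclideanSpace ℝ (Fin n)), IsCompact K ∧ μ Kᶜ = 0) ∧
    ∃ Λ : Set (EuclideanSpace ℝ (Fin n)), IsSpectrum μ Λ

/-- The mask polynomial `m_D(ξ) = (1/#D) ∑_{d ∈ D} e^{2πi⟨ξ,d⟩}`. -/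
def maskPoly {n : ℕ} (D : Finset (Fin n → ℤ)) (ξ : EuclideanSpace ℝ (Fin n)) : ℂ :=
  (1 / (D.card : ℂ)) *
    ∑ d ∈ D, Complex.exp (2 * Real.pi * Complex.I * (inner ℝ ξ (intVec d) : ℝ))

/-- The zero set `𝒵(m_D)`. -/
def maskZeros {n : ℕ} (D : Finset (Fin n → ℤ)) : Set (EuclideanSpace ℝ (Fin n)) :=
  {ξ | maskPoly D ξ = 0}

/-- `⋃_{j=1}^{m-1} ((j/m) ν + ℤⁿ)`. -/
def latticeCosets {n : ℕ} (m : ℕ) (ν : Fin n → ℤ) : Set (EuclideanSpace ℝ (Fin n)) :=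
  {ξ | ∃ j : ℕ, 1 ≤ j ∧ j ≤ m - 1 ∧ ∃ z : Fin n → ℤ,
    ξ = ((j : ℝ) / (m : ℝ)) • intVec ν + intVec z}

/-- The cube `[-1/2 - δ, 1/2 + δ]ⁿ`. -/
def cube (n : ℕ) (δ : ℝ) : Set (EuclideanSpace ℝ (Fin n)) :=
  {x | ∀ i, x i ∈ Set.Icc (-(1 / 2) - δ) (1 / 2 + δ)}

/-- The set `𝒜_{δ,β}` of integer matrices `A` such that `A⁻¹ [-1/2 - δ, 1/2 + δ]ⁿ` does not meet the
`β`-neighbourhood of `⋃_{k ≥ 1} 𝒵(m_{D_k})`. -/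
def admissible {n : ℕ} (D : ℕ → Finset (Fin n → ℤ)) (δ β : ℝ) :
    Set (Matrix (Fin n) (Fin n) ℤ) :=
  {A | (euclMap (realMat A) ⁻¹' cube n δ) ∩
    Metric.thickening β (⋃ k ∈ Set.Ici 1, maskZeros (D k)) = ∅}

/-- `R_{k+1}ᵗ R_{k+2}ᵗ ⋯ R_{k+p}ᵗ`. -/
def transposeProd {n : ℕ} (R : ℕ → Matrix (Fin n) (Fin n) ℤ) (k : ℕ) :
    ℕ → Matrix (Fin n) (Fin n) ℤ
  | 0 => 1
  | p + 1 => transposeProd R k p * (R (k + p + 1))ᵀ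

end Moran

end

open MeasureTheory Filter Topology
open scoped BoundedContinuousFunction ENNReal Matrix

noncomputable section

namespace Moran

section Fourier

variable {n : ℕ}

local notation "𝔼" => EuclideanSpace ℝ (Fin n)

/-- The Fourier transform `ξ ↦ ∫ e^{2πi⟨ξ,x⟩} dμ(x)`. -/
def ft (μ : Measure (EuclideanSpace ℝ (Fin n))) (ξ : EuclideanSpace ℝ (Fin n)) : ℂ :=
  ∫ x, Complex.exp (2 * Real.pi * Complex.I * (inner ℝ ξ x : ℝ)) ∂μ

theorem ft_eq_charFun (μ : Measure 𝔼) (ξ : 𝔼) : ft μ ξ = charFun μ ((2 * Real.pi) • ξ) := by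
  rw [ft, charFun_apply]
  congr 1
  ext x
  rw [inner_smul_right, real_inner_comm]
  push_cast
  ring_nf

theorem continuous_ft (μ : Measure 𝔼) [IsProbabilityMeasure μ] : Continuous (ft μ) := by
  have : ft μ = fun ξ => charFun μ ((2 * Real.pi) • ξ) := funext (ft_eq_charFun μ)
  rw [this]
  exact continuous_charFun.comp (by fun_prop)

theorem ft_zero (μ : Measure 𝔼) [IsProbabilityMeasure μ] : ft μ 0 = 1 := by
  simp [ft_eq_charFun, charFun_zero]

theorem ft_neg (μ : Measure 𝔼) (ξ : 𝔼) : ft μ (-ξ) = starRingEnd ℂ (ft μ ξ) := by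
  rw [ft_eq_charFun, ft_eq_charFun, smul_neg, charFun_neg]

theorem norm_ft_le_one (μ : Measure 𝔼) [IsProbabilityMeasure μ] (ξ : 𝔼) : ‖ft μ ξ‖ ≤ 1 := by
  rw [ft_eq_charFun]; exact norm_charFun_le_one _

theorem ae_eq_zero_of_forall_integral_char_mul_eq_zero_real (μ : Measure 𝔼)
    {g : 𝔼 → ℝ} (hg : Integrable g μ)
    (h : ∀ t : 𝔼, ∫ x, Complex.exp ((inner ℝ x t : ℝ) * Complex.I) * g x ∂μ = 0) : g =ᵐ[μ] 0 := by
  have hfin : ∀ f : 𝔼 → ℝ, Integrable f μ →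
      IsFiniteMeasure (μ.withDensity fun x => ENNReal.ofReal (f x)) := fun f hf =>
    isFiniteMeasure_withDensity_ofReal hf.2
  have hcf : ∀ f : 𝔼 → ℝ, Integrable f μ → ∀ t,
      charFun (μ.withDensity fun x => ENNReal.ofReal (f x)) t =
        ∫ x, Complex.exp ((inner ℝ x t : ℝ) * Complex.I) * (max (f x) 0 : ℝ) ∂μ := by
    intro f hf t
    rw [charFun_apply, integral_withDensity_eq_integral_toReal_smul₀
      hf.1.aemeasurable.ennreal_ofReal (Eventually.of_forall fun _ => ENNReal.ofReal_lt_top)]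
    refine integral_congr_ae (Eventually.of_forall fun x => ?_)
    simp only [ENNReal.toReal_ofReal', Complex.real_smul]
    ring
  have hint : ∀ f : 𝔼 → ℝ, Integrable f μ → ∀ t : 𝔼,
      Integrable (fun x => Complex.exp ((inner ℝ x t : ℝ) * Complex.I) * (max (f x) 0 : ℝ)) μ := by
    intro f hf t
    refine Integrable.bdd_mul (c := 1) hf.pos_part.ofReal (by fun_prop) ?_
    exact Eventually.of_forall fun x => (Complex.norm_exp_ofReal_mul_I _).le
  have := hfin g hg
  have := hfin (fun x => -g x) hg.neg
  have heq : (μ.withDensity fun x => ENNReal.ofReal (g x)) =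
      μ.withDensity fun x => ENNReal.ofReal (-g x) := by
    refine Measure.ext_of_charFun (funext fun t => ?_)
    have hneg : Integrable (fun x => Complex.exp ((inner ℝ x t : ℝ) * Complex.I) *
      (max (-g x) 0 : ℝ)) μ := hint _ hg.neg t
    rw [hcf g hg, hcf (fun x => -g x) hg.neg, ← sub_eq_zero,
      ← integral_sub (hint g hg t) hneg, ← h t]
    refine integral_congr_ae (Eventually.of_forall fun x => ?_)
    simp only
    rw [← mul_sub, ← Complex.ofReal_sub]
    congr 2
    rcases le_total (g x) 0 with hx | hx
    · rw [max_eq_right hx, max_eq_left (by linarith)]; ring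
    · rw [max_eq_left hx, max_eq_right (by linarith)]; ring
  replace heq := (withDensity_eq_iff hg.1.aemeasurable.ennreal_ofReal
    (g := fun x => ENNReal.ofReal (-g x)) hg.neg.1.aemeasurable.ennreal_ofReal
    hg.lintegral_lt_top.ne).1 heq
  filter_upwards [heq] with x hx
  rcases lt_trichotomy (g x) 0 with h0 | h0 | h0
  · rw [ENNReal.ofReal_of_nonpos h0.le, eq_comm, ENNReal.ofReal_eq_zero] at hx
    linarith
  · exact h0
  · rw [ENNReal.ofReal_of_nonpos (by linarith : -g x ≤ 0), ENNReal.ofReal_eq_zero] at hx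
    linarith

theorem ae_eq_zero_of_forall_integral_char_mul_eq_zero (μ : Measure 𝔼)
    {f : 𝔼 → ℂ} (hf : Integrable f μ)
    (h : ∀ t : 𝔼, ∫ x, Complex.exp ((inner ℝ x t : ℝ) * Complex.I) * f x ∂μ = 0) : f =ᵐ[μ] 0 := by
  have hint : ∀ g : 𝔼 → ℂ, Integrable g μ → ∀ t : 𝔼,
      Integrable (fun x => Complex.exp ((inner ℝ x t : ℝ) * Complex.I) * g x) μ := fun g hg t =>
    Integrable.bdd_mul (c := 1) hg (by fun_prop)
      (Eventually.of_forall fun x => (Complex.norm_exp_ofReal_mul_I _).le)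
  have hre : ∀ g : 𝔼 → ℂ, Integrable g μ →
      (∀ t : 𝔼, ∫ x, Complex.exp ((inner ℝ x t : ℝ) * Complex.I) * g x ∂μ = 0) →
      (fun x => (g x).re) =ᵐ[μ] 0 := by
    intro g hg h
    refine ae_eq_zero_of_forall_integral_char_mul_eq_zero_real μ hg.re fun t => ?_
    have hconj : ∫ x, Complex.exp ((inner ℝ x t : ℝ) * Complex.I) * starRingEnd ℂ (g x) ∂μ = 0 := by
      have h1 := congrArg (starRingEnd ℂ) (h (-t))
      rw [← integral_conj, map_zero] at h1
      rw [← h1]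
      refine integral_congr_ae (Eventually.of_forall fun x => ?_)
      simp only [map_mul]
      rw [← Complex.exp_conj]
      simp
    have hgc : Integrable (fun x => starRingEnd ℂ (g x)) μ :=
      (Complex.conjCLE.toContinuousLinearMap.integrable_comp hg)
    have h2 : ∫ x, (Complex.exp ((inner ℝ x t : ℝ) * Complex.I) * g x +
        Complex.exp ((inner ℝ x t : ℝ) * Complex.I) * starRingEnd ℂ (g x)) ∂μ = 0 := by
      rw [integral_add (hint g hg t) (hint _ hgc t), h, hconj, add_zero]
    have h3 : ∫ x, (2 : ℂ) * (Complex.exp ((inner ℝ x t : ℝ) * Complex.I) * ((g x).re : ℝ)) ∂μ = 0 := by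
      rw [← h2]
      refine integral_congr_ae (Eventually.of_forall fun x => ?_)
      simp only
      rw [← mul_add, Complex.add_conj]
      push_cast
      ring
    rw [integral_const_mul] at h3
    simpa using h3
  have h1 := hre f hf h
  have h2 := hre (fun x => -Complex.I * f x) (hf.const_mul _) fun t => by
    have : ∀ x, Complex.exp ((inner ℝ x t : ℝ) * Complex.I) * (-Complex.I * f x) =
      -Complex.I * (Complex.exp ((inner ℝ x t : ℝ) * Complex.I) * f x) := fun x => by ring
    simp_rw [this]
    rw [integral_const_mul, h, mul_zero]
  filter_upwards [h1, h2] with x hx1 hx2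
  apply Complex.ext
  · simpa using hx1
  · simpa using hx2

theorem norm_char (a : ℝ) : ‖Complex.exp (2 * Real.pi * Complex.I * (a : ℝ))‖ = 1 := by
  have : (2 * Real.pi * Complex.I * (a : ℝ) : ℂ) = ((2 * Real.pi * a : ℝ) : ℂ) * Complex.I := by
    push_cast; ring
  rw [this, Complex.norm_exp_ofReal_mul_I]

theorem memLp_char (μ : Measure 𝔼) [IsProbabilityMeasure μ] (ξ : 𝔼) :
    MemLp (fun x : 𝔼 => Complex.exp (2 * Real.pi * Complex.I * (inner ℝ ξ x : ℝ))) 2 μ :=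
  MemLp.of_bound (by fun_prop) 1 (Eventually.of_forall fun x => (norm_char _).le)

/-- The exponential `x ↦ e^{2πi⟨ξ,x⟩}` in `L²(μ)`. -/
def expL2 (μ : Measure (EuclideanSpace ℝ (Fin n))) [IsProbabilityMeasure μ]
    (ξ : EuclideanSpace ℝ (Fin n)) : Lp ℂ 2 μ :=
  (memLp_char μ ξ).toLp

variable (μ : Measure (EuclideanSpace ℝ (Fin n))) [IsProbabilityMeasure μ]

theorem inner_expL2 (f : Lp ℂ 2 μ) (ξ : 𝔼) : inner ℂ (expL2 μ ξ) f =
    ∫ x, Complex.exp (2 * Real.pi * Complex.I * (inner ℝ (-ξ) x : ℝ)) * f x ∂μ := by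
  rw [L2.inner_def]
  refine integral_congr_ae ?_
  filter_upwards [(memLp_char μ ξ).coeFn_toLp] with x hx
  rw [expL2, hx, RCLike.inner_apply', ← Complex.exp_conj]
  congr 2
  simp [inner_neg_left, Complex.conj_ofNat]

theorem inner_expL2_expL2 (a b : 𝔼) : inner ℂ (expL2 μ a) (expL2 μ b) = ft μ (b - a) := by
  rw [inner_expL2, ft]
  refine integral_congr_ae ?_
  filter_upwards [(memLp_char μ b).coeFn_toLp] with x hx
  rw [expL2, hx, ← Complex.exp_add]
  congr 1
  simp only [inner_sub_left, inner_neg_left]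
  push_cast
  ring

theorem norm_expL2 (a : 𝔼) : ‖expL2 μ a‖ = 1 := by
  have h' : ‖expL2 μ a‖ ^ 2 = 1 := by
    rw [InnerProductSpace.norm_sq_eq_re_inner (𝕜 := ℂ), inner_expL2_expL2, sub_self, ft_zero]
    simp
  exact (pow_eq_one_iff_of_nonneg (norm_nonneg _) two_ne_zero).1 h'

theorem continuous_expL2 : Continuous (expL2 μ) := by
  rw [continuous_iff_continuousAt]
  intro a
  rw [ContinuousAt, tendsto_iff_norm_sub_tendsto_zero]
  have h : ∀ b, ‖expL2 μ b - expL2 μ a‖ = √(2 - 2 * (ft μ (a - b)).re) := by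
    intro b
    rw [eq_comm, Real.sqrt_eq_iff_eq_sq _ (norm_nonneg _),
      @norm_sub_sq ℂ, norm_expL2, norm_expL2, inner_expL2_expL2]
    · simp; ring
    · have := (Complex.re_le_norm _).trans (norm_ft_le_one μ (a - b))
      linarith
  simp_rw [h]
  have hc : Continuous fun b => √(2 - 2 * (ft μ (a - b)).re) := by
    have := continuous_ft μ
    fun_prop
  have := hc.tendsto a
  simpa [ft_zero] using this

theorem eq_zero_of_forall_inner_expL2_eq_zero {f : Lp ℂ 2 μ}
    (h : ∀ ξ, inner ℂ (expL2 μ ξ) f = 0) : f = 0 := by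
  have hf : Integrable f μ := (Lp.memLp f).integrable (by norm_num)
  rw [Lp.eq_zero_iff_ae_eq_zero]
  refine ae_eq_zero_of_forall_integral_char_mul_eq_zero μ hf fun t => ?_
  rw [← h (-((2 * Real.pi)⁻¹ • t)), inner_expL2]
  refine integral_congr_ae (Eventually.of_forall fun x => ?_)
  simp only
  congr 2
  rw [neg_neg, real_inner_smul_left, real_inner_comm]
  have : (Real.pi : ℂ) ≠ 0 := by exact_mod_cast Real.pi_ne_zero
  push_cast
  field_simp

variable {μ}

theorem IsSpectrum.hasSum {Λ : Set 𝔼} (h : IsSpectrum μ Λ) (ξ : 𝔼) :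
    HasSum (fun l : Λ => ‖ft μ (ξ + l)‖ ^ 2) 1 := by
  obtain ⟨-, b, hb⟩ := h
  have hbe : ∀ l : Λ, b l = expL2 μ (-(l : 𝔼)) := by
    intro l
    refine Lp.ext ((hb l).trans ?_)
    filter_upwards [(memLp_char μ (-(l : 𝔼))).coeFn_toLp] with x hx
    rw [expL2, hx]
    congr 1
    rw [inner_neg_left]
    push_cast
    ring
  have h1 := Complex.hasSum_re (b.hasSum_inner_mul_inner (expL2 μ ξ) (expL2 μ ξ))
  simp_rw [hbe, inner_expL2_expL2, sub_self, ft_zero, Complex.one_re] at h1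
  convert h1 using 2 with l
  rw [← neg_sub, ft_neg, sub_neg_eq_add, mul_comm, Complex.mul_conj, Complex.ofReal_re,
    Complex.normSq_eq_norm_sq]

theorem expL2_orthonormal {Λ : Set 𝔼} (h : ∀ a ∈ Λ, ∀ b ∈ Λ, a ≠ b → ft μ (a - b) = 0) :
    Orthonormal ℂ fun l : Λ => expL2 μ (-(l : 𝔼)) := by
  refine ⟨fun l => norm_expL2 μ _, fun a b hab => ?_⟩
  simp only [inner_expL2_expL2, neg_sub_neg]
  exact h _ a.2 _ b.2 fun hh => hab (Subtype.ext hh)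

theorem norm_inner_expL2_neg (l ξ : 𝔼) :
    ‖inner ℂ (expL2 μ (-l)) (expL2 μ ξ)‖ = ‖ft μ (ξ + l)‖ := by
  rw [inner_expL2_expL2, sub_neg_eq_add]

theorem summable_of_orthogonal {Λ : Set 𝔼} (h : ∀ a ∈ Λ, ∀ b ∈ Λ, a ≠ b → ft μ (a - b) = 0)
    (ξ : 𝔼) : Summable fun l : Λ => ‖ft μ (ξ + l)‖ ^ 2 := by
  have := (expL2_orthonormal h).inner_products_summable (expL2 μ ξ)
  simpa only [norm_inner_expL2_neg] using this

theorem tsum_le_one_of_orthogonal {Λ : Set 𝔼} (h : ∀ a ∈ Λ, ∀ b ∈ Λ, a ≠ b → ft μ (a - b) = 0)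
    (ξ : 𝔼) : ∑' l : Λ, ‖ft μ (ξ + l)‖ ^ 2 ≤ 1 := by
  have := (expL2_orthonormal h).tsum_inner_products_le (expL2 μ ξ)
  simpa only [norm_inner_expL2_neg, norm_expL2, one_pow] using this

theorem isSpectrum_of_orthogonal_of_dense {Λ : Set 𝔼} (hΛ : Λ.Countable)
    (h : ∀ a ∈ Λ, ∀ b ∈ Λ, a ≠ b → ft μ (a - b) = 0) {s : Set 𝔼} (hs : Dense s)
    (hsum : ∀ ξ ∈ s, ∑' l : Λ, ‖ft μ (ξ + l)‖ ^ 2 = 1) : IsSpectrum μ Λ := by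
  have hon := expL2_orthonormal h
  set S : Submodule ℂ (Lp ℂ 2 μ) :=
    (Submodule.span ℂ (Set.range fun l : Λ => expL2 μ (-(l : 𝔼)))).topologicalClosure with hS
  have hSc : IsClosed (S : Set (Lp ℂ 2 μ)) := Submodule.isClosed_topologicalClosure _
  have : CompleteSpace S := hSc.completeSpace_coe
  have hmem : ∀ ξ ∈ s, expL2 μ ξ ∈ S := by
    intro ξ hξ
    have hb := hon.tsum_inner_products_le (S.starProjection (expL2 μ ξ))
    have hin : ∀ l : Λ, inner ℂ (expL2 μ (-(l : 𝔼))) (S.starProjection (expL2 μ ξ)) =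
        inner ℂ (expL2 μ (-(l : 𝔼))) (expL2 μ ξ) := by
      intro l
      have hl : expL2 μ (-(l : 𝔼)) ∈ S :=
        Submodule.le_topologicalClosure _ (Submodule.subset_span ⟨l, rfl⟩)
      have := S.sub_starProjection_mem_orthogonal (expL2 μ ξ)
      have := (Submodule.mem_orthogonal _ _).1 this _ hl
      rw [inner_sub_right, sub_eq_zero] at this
      exact this.symm
    simp_rw [hin, norm_inner_expL2_neg, hsum ξ hξ] at hb
    have hpy := S.norm_sq_eq_add_norm_sq_starProjection (expL2 μ ξ)
    rw [norm_expL2] at hpy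
    have h0 : ‖Sᗮ.starProjection (expL2 μ ξ)‖ ^ 2 ≤ 0 := by linarith
    have h0' : Sᗮ.starProjection (expL2 μ ξ) = 0 := by simpa using h0
    have hadd := S.starProjection_add_starProjection_orthogonal (expL2 μ ξ)
    rw [h0', add_zero] at hadd
    rw [← hadd]
    exact Submodule.starProjection_apply_mem _ _
  have hall : ∀ ξ, expL2 μ ξ ∈ S := by
    intro ξ
    have := (hSc.preimage (continuous_expL2 μ)).closure_subset_iff.2 hmem
    exact this (hs ξ)
  have htop : (Submodule.span ℂ (Set.range fun l : Λ => expL2 μ (-(l : 𝔼))))ᗮ = ⊥ := by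
    rw [Submodule.eq_bot_iff]
    intro f hf
    refine eq_zero_of_forall_inner_expL2_eq_zero μ fun ξ => ?_
    rw [← Submodule.orthogonal_closure] at hf
    exact (Submodule.mem_orthogonal _ _).1 hf _ (hall ξ)
  refine ⟨hΛ, HilbertBasis.mkOfOrthogonalEqBot hon htop, fun l => ?_⟩
  rw [HilbertBasis.coe_mkOfOrthogonalEqBot]
  filter_upwards [(memLp_char μ (-(l : 𝔼))).coeFn_toLp] with x hx
  rw [expL2, hx]
  congr 1
  rw [inner_neg_left]
  push_cast
  ring

theorem orthogonal_of_hasSum {Λ : Set 𝔼}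
    (hsum : ∀ ξ, HasSum (fun l : Λ => ‖ft μ (ξ + l)‖ ^ 2) 1) :
    ∀ a ∈ Λ, ∀ b ∈ Λ, a ≠ b → ft μ (a - b) = 0 := by
  intro a ha b hb hab
  have h1 := sum_le_hasSum {⟨a, ha⟩, ⟨b, hb⟩} (fun _ _ => by positivity) (hsum (-b))
  rw [Finset.sum_pair (by simpa using hab)] at h1
  simp only [neg_add_cancel, ft_zero, norm_one] at h1
  rw [neg_add_eq_sub] at h1
  have : ‖ft μ (a - b)‖ ^ 2 ≤ 0 := by linarith
  simpa using this

theorem isSpectrum_of_hasSum {Λ : Set 𝔼} (hΛ : Λ.Countable)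
    (hsum : ∀ ξ, HasSum (fun l : Λ => ‖ft μ (ξ + l)‖ ^ 2) 1) : IsSpectrum μ Λ :=
  isSpectrum_of_orthogonal_of_dense hΛ (orthogonal_of_hasSum hsum) dense_univ
    fun ξ _ => (hsum ξ).tsum_eq

end Fourier

section Selection

variable {V : Type*} [AddCommGroup V] {Z : AddSubgroup V} {g : V} {m : ℕ}

theorem tsum_fiber_zmultiples {Q : Type*} [AddCommGroup Q] {g : Q} (hm : 0 < m)
    (hg : addOrderOf g = m) (p : Q → ℝ≥0∞) (hp : ∀ κ, ∑ j ∈ Finset.range m, p (κ + j • g) = 1)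
    (f : Q ⧸ AddSubgroup.zmultiples g → ℝ≥0∞) :
    ∑' κ : Q, p κ * f (QuotientAddGroup.mk κ) = ∑' i, f i := by
  rw [← ENNReal.tsum_fiberwise _ (QuotientAddGroup.mk (s := AddSubgroup.zmultiples g))]
  refine tsum_congr fun i => ?_
  obtain ⟨κ₀, rfl⟩ := QuotientAddGroup.mk_surjective i
  have hmem : ∀ j : Fin m, κ₀ + (j : ℕ) • g ∈
      (QuotientAddGroup.mk (s := AddSubgroup.zmultiples g)) ⁻¹' {QuotientAddGroup.mk κ₀} := by
    intro j
    rw [Set.mem_preimage, Set.mem_singleton_iff, eq_comm, QuotientAddGroup.eq]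
    simp
  let e : Fin m → (QuotientAddGroup.mk (s := AddSubgroup.zmultiples g)) ⁻¹'
      {QuotientAddGroup.mk κ₀} := fun j => ⟨κ₀ + (j : ℕ) • g, hmem j⟩
  have he : Function.Bijective e := by
    constructor
    · intro a b hab
      have h1 : (a : ℕ) • g = (b : ℕ) • g := by simpa [e] using hab
      have := nsmul_injOn_Iio_addOrderOf (x := g) (by simp [hg]) (by simp [hg]) h1
      exact Fin.ext this
    · rintro ⟨κ, hκ⟩
      rw [Set.mem_preimage, Set.mem_singleton_iff, eq_comm, QuotientAddGroup.eq] at hκ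
      obtain ⟨k, hk⟩ := AddSubgroup.mem_zmultiples_iff.1 hκ
      have hm0 : (m : ℤ) ≠ 0 := by exact_mod_cast hm.ne'
      refine ⟨⟨(k % m).toNat, ?_⟩, ?_⟩
      · have := Int.emod_lt_of_pos k (b := m) (by exact_mod_cast hm)
        have := Int.emod_nonneg k hm0
        omega
      · apply Subtype.ext
        have h2 : ((k % m).toNat : ℤ) • g = k • g := by
          rw [Int.toNat_of_nonneg (Int.emod_nonneg k hm0), ← hg, mod_addOrderOf_zsmul]
        rw [natCast_zsmul] at h2
        simp only [e]
        rw [h2, hk]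
        abel
  rw [← (Equiv.ofBijective e he).tsum_eq, tsum_fintype]
  have : ∀ j : Fin m, (QuotientAddGroup.mk (κ₀ + (j : ℕ) • g) : Q ⧸ AddSubgroup.zmultiples g) =
    QuotientAddGroup.mk κ₀ := fun j => hmem j
  simp only [Equiv.ofBijective_apply, e, this]
  rw [← Finset.sum_mul, Fin.sum_univ_eq_sum_range (fun j => p (κ₀ + j • g)), hp, one_mul]

variable (Z g) in
/-- The points of `Λ` that lie in the coset of `Z` selected by `s`, a function that assigns to
each coset of `Z + ℤ g` a coset of `Z`. -/
def selected (Λ : Set V)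
    (s : (V ⧸ Z) ⧸ AddSubgroup.zmultiples (g : V ⧸ Z) → V ⧸ Z) : Set V :=
  {l | l ∈ Λ ∧ s (QuotientAddGroup.mk (l : V ⧸ Z)) = (l : V ⧸ Z)}

open Classical in
/-- The sum of `w` over the points of `Λ` in the coset `κ`. -/
def cosetSum (Λ : Set V) (w : V → ℝ≥0∞) (κ : V ⧸ Z) : ℝ≥0∞ :=
  ∑' l : Λ, if ((l : V) : V ⧸ Z) = κ then w l else 0

theorem tsum_selected (Λ : Set V) (w : V → ℝ≥0∞)
    (s : (V ⧸ Z) ⧸ AddSubgroup.zmultiples (g : V ⧸ Z) → V ⧸ Z)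
    (hs : ∀ i, QuotientAddGroup.mk (s i) = i) :
    ∑' l : selected Z g Λ s, w l = ∑' i, cosetSum Λ w (s i) := by
  classical
  simp only [cosetSum]
  rw [ENNReal.tsum_comm]
  have : ∀ l : Λ, ∑' i, (if ((l : V) : V ⧸ Z) = s i then w l else 0) =
      (selected Z g Λ s).indicator w l := by
    intro l
    rw [tsum_eq_single (QuotientAddGroup.mk ((l : V) : V ⧸ Z))]
    · rw [Set.indicator_apply]
      congr 1
      simp [selected, eq_comm]
    · intro i hi
      rw [if_neg]
      intro h
      exact hi (by rw [h, hs])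
  simp_rw [this]
  rw [tsum_subtype, tsum_subtype Λ, Set.indicator_indicator]
  congr 1
  ext x
  congr 1
  ext y
  simp only [selected, Set.mem_ofPred_eq, Set.mem_inter_iff]
  tauto

theorem tsum_mul_cosetSum (Λ : Set V) (w : V → ℝ≥0∞) (p : V ⧸ Z → ℝ≥0∞) :
    ∑' κ, p κ * cosetSum Λ w κ = ∑' l : Λ, p ((l : V) : V ⧸ Z) * w l := by
  classical
  simp only [cosetSum, ← ENNReal.tsum_mul_left]
  rw [ENNReal.tsum_comm]
  refine tsum_congr fun l => ?_
  rw [tsum_eq_single ((l : V) : V ⧸ Z)]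
  · simp
  · intro κ hκ
    rw [if_neg (Ne.symm hκ), mul_zero]

theorem cosetSum_eq_zero {Λ : Set V} {w : V → ℝ≥0∞} {κ : V ⧸ Z}
    (h : ∀ l ∈ Λ, (l : V ⧸ Z) ≠ κ) : cosetSum Λ w κ = 0 := by
  rw [cosetSum, ENNReal.tsum_eq_zero]
  intro l
  rw [if_neg (h l l.2)]

theorem exists_maximal_section (hm : 0 < m) (hg : addOrderOf (g : V ⧸ Z) = m)
    (W : V ⧸ Z → ℝ≥0∞) : ∃ s : (V ⧸ Z) ⧸ AddSubgroup.zmultiples (g : V ⧸ Z) → V ⧸ Z,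
      (∀ i, QuotientAddGroup.mk (s i) = i) ∧ ∀ κ, W κ ≤ W (s (QuotientAddGroup.mk κ)) := by
  have hfin : (AddSubgroup.zmultiples (g : V ⧸ Z) : Set (V ⧸ Z)).Finite := by
    have : 0 < addOrderOf (g : V ⧸ Z) := by rw [hg]; exact hm
    exact (addOrderOf_pos_iff.1 this).finite_zmultiples
  have hex : ∀ i : (V ⧸ Z) ⧸ AddSubgroup.zmultiples (g : V ⧸ Z), ∃ κ : V ⧸ Z,
      QuotientAddGroup.mk κ = i ∧ ∀ κ', QuotientAddGroup.mk κ' = i → W κ' ≤ W κ := by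
    intro i
    obtain ⟨κ₀, rfl⟩ := QuotientAddGroup.mk_surjective i
    obtain ⟨h, hh, hmax⟩ := hfin.exists_maximalFor (fun h => W (κ₀ + h)) _ ⟨0, zero_mem _⟩
    refine ⟨κ₀ + h, ?_, fun κ' hκ' => ?_⟩
    · rw [eq_comm, QuotientAddGroup.eq]
      simpa using hh
    · rw [eq_comm, QuotientAddGroup.eq] at hκ'
      by_contra! hlt
      have := hmax hκ' (by simpa using hlt.le)
      simp only [add_neg_cancel_left] at this
      exact absurd this (not_le.2 hlt)
  choose s hs1 hs2 using hex
  exact ⟨s, hs1, fun κ => hs2 _ κ rfl⟩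

theorem cosetSum_add_eq_and_tsum_selected_eq_one (hm : 0 < m) (hg : addOrderOf (g : V ⧸ Z) = m)
    (Λ : Set V) (w : V → ℝ≥0∞) (p : V ⧸ Z → ℝ≥0∞)
    (hp : ∀ κ, ∑ j ∈ Finset.range m, p (κ + j • (g : V ⧸ Z)) = 1)
    (hp0 : ∀ l ∈ Λ, ∀ κ, κ - (l : V ⧸ Z) ∈ AddSubgroup.zmultiples (g : V ⧸ Z) → p κ ≠ 0)
    (hsum : ∑' l : Λ, p ((l : V) : V ⧸ Z) * w l = 1)
    (hle : ∀ s : (V ⧸ Z) ⧸ AddSubgroup.zmultiples (g : V ⧸ Z) → V ⧸ Z,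
      ∑' l : selected Z g Λ s, w l ≤ 1) :
    (∀ κ κ' : V ⧸ Z, κ - κ' ∈ AddSubgroup.zmultiples (g : V ⧸ Z) →
      cosetSum Λ w κ = cosetSum Λ w κ') ∧
    ∀ s : (V ⧸ Z) ⧸ AddSubgroup.zmultiples (g : V ⧸ Z) → V ⧸ Z,
      (∀ i, QuotientAddGroup.mk (s i) = i) → ∑' l : selected Z g Λ s, w l = 1 := by
  obtain ⟨s, hs, hmax⟩ := exists_maximal_section hm hg (cosetSum Λ w)
  have htop : ∀ κ, p κ ≠ ⊤ := by
    intro κ h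
    have := Finset.single_le_sum (f := fun j => p (κ + j • (g : V ⧸ Z)))
      (fun _ _ => zero_le) (Finset.mem_range.2 hm)
    rw [hp] at this
    simp [h] at this
  have h1 : ∑' κ : V ⧸ Z, p κ * cosetSum Λ w (s (QuotientAddGroup.mk κ)) =
      ∑' i, cosetSum Λ w (s i) :=
    tsum_fiber_zmultiples hm hg p hp fun i => cosetSum Λ w (s i)
  rw [← tsum_mul_cosetSum] at hsum
  have hle1 : ∑' i, cosetSum Λ w (s i) ≤ 1 := by
    rw [← tsum_selected Λ w s hs]
    exact hle s
  have hterm : ∀ κ, p κ * cosetSum Λ w κ ≤ p κ * cosetSum Λ w (s (QuotientAddGroup.mk κ)) :=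
    fun κ => mul_le_mul_right (hmax κ) _
  have hone : ∑' i, cosetSum Λ w (s i) = 1 := by
    refine le_antisymm hle1 ?_
    rw [← hsum, ← h1]
    exact ENNReal.tsum_le_tsum hterm
  have heq : ∀ κ, p κ * cosetSum Λ w κ = p κ * cosetSum Λ w (s (QuotientAddGroup.mk κ)) := by
    intro κ
    refine le_antisymm (hterm κ) ?_
    by_contra! hlt
    have := ENNReal.tsum_lt_tsum (by rw [hsum]; simp) hterm hlt
    rw [hsum, h1, hone] at this
    exact lt_irrefl _ this
  have hW : ∀ κ, cosetSum Λ w κ = cosetSum Λ w (s (QuotientAddGroup.mk κ)) := by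
    intro κ
    by_cases hκ : ∃ l ∈ Λ, κ - (l : V ⧸ Z) ∈ AddSubgroup.zmultiples (g : V ⧸ Z)
    · obtain ⟨l, hl, hlκ⟩ := hκ
      exact (ENNReal.mul_right_inj (hp0 l hl κ hlκ) (htop κ)).1 (heq κ)
    · push Not at hκ
      have hz : ∀ κ' : V ⧸ Z, κ - κ' ∈ AddSubgroup.zmultiples (g : V ⧸ Z) →
          cosetSum Λ w κ' = 0 := fun κ' h => cosetSum_eq_zero fun l hl hlκ' =>
        hκ l hl (by rw [hlκ']; exact h)
      rw [hz κ (by simp), hz]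
      have := hs (QuotientAddGroup.mk κ)
      rw [QuotientAddGroup.eq] at this
      rwa [neg_add_eq_sub] at this
  have hmk : ∀ κ κ' : V ⧸ Z, κ - κ' ∈ AddSubgroup.zmultiples (g : V ⧸ Z) →
      (QuotientAddGroup.mk κ : (V ⧸ Z) ⧸ AddSubgroup.zmultiples (g : V ⧸ Z)) =
        QuotientAddGroup.mk κ' := by
    intro κ κ' h
    rw [eq_comm, QuotientAddGroup.eq, neg_add_eq_sub]
    exact h
  refine ⟨fun κ κ' h => by rw [hW κ, hW κ', hmk κ κ' h], fun s' hs' => ?_⟩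
  rw [tsum_selected Λ w s' hs', ← hone]
  refine tsum_congr fun i => ?_
  rw [hW (s' i), hs']

end Selection

section Mask

variable {n m : ℕ} {D : Finset (Fin n → ℤ)} {ν : Fin n → ℤ}

local notation "𝔼" => EuclideanSpace ℝ (Fin n)

theorem intVec_apply (a : Fin n → ℤ) (i : Fin n) : intVec a i = (a i : ℝ) := rfl

theorem intVec_zero : intVec (0 : Fin n → ℤ) = 0 := by
  ext i; simp [intVec_apply]

theorem intVec_add (a b : Fin n → ℤ) : intVec (a + b) = intVec a + intVec b := by
  ext i; simp [intVec_apply]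

theorem inner_intVec_intVec (a b : Fin n → ℤ) :
    inner ℝ (intVec a) (intVec b) = ((∑ i, a i * b i : ℤ) : ℝ) := by
  rw [PiLp.inner_apply]
  simp [intVec_apply, mul_comm]

theorem exp_two_pi_int (k : ℤ) : Complex.exp (2 * Real.pi * Complex.I * ((k : ℝ) : ℂ)) = 1 := by
  rw [Complex.exp_eq_one_iff]
  exact ⟨k, by push_cast; ring⟩

theorem maskPoly_add_intVec (D : Finset (Fin n → ℤ)) (ξ : 𝔼) (z : Fin n → ℤ) :
    maskPoly D (ξ + intVec z) = maskPoly D ξ := by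
  unfold maskPoly
  congr 1
  refine Finset.sum_congr rfl fun d _ => ?_
  rw [inner_add_left, inner_intVec_intVec, Complex.ofReal_add, mul_add, Complex.exp_add,
    exp_two_pi_int, mul_one]

theorem maskPoly_neg (D : Finset (Fin n → ℤ)) (ξ : 𝔼) :
    maskPoly D (-ξ) = starRingEnd ℂ (maskPoly D ξ) := by
  unfold maskPoly
  rw [map_mul, map_sum]
  simp only [← Complex.exp_conj]
  congr 1
  · simp
  · refine Finset.sum_congr rfl fun d _ => ?_
    simp [inner_neg_left, Complex.conj_ofNat]

theorem continuous_maskPoly (D : Finset (Fin n → ℤ)) : Continuous (maskPoly D) := by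
  unfold maskPoly
  fun_prop

theorem sum_norm_maskPoly_sq_eq_one (hm : 0 < m) (hD : D.card = m)
    (hzero : ∀ j : ℕ, 1 ≤ j → j ≤ m - 1 → maskPoly D (((j : ℝ) / m) • intVec ν) = 0) (ξ : 𝔼) :
    ∑ j ∈ Finset.range m, ‖maskPoly D (ξ + ((j : ℝ) / m) • intVec ν)‖ ^ 2 = 1 := by
  have hmC : (m : ℂ) ≠ 0 := by exact_mod_cast hm.ne'
  set e : ℝ → ℂ := fun a => Complex.exp (2 * Real.pi * Complex.I * (a : ℝ)) with he
  have he_add : ∀ a b, e (a + b) = e a * e b := fun a b => by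
    simp only [he]
    rw [Complex.ofReal_add, mul_add, Complex.exp_add]
  have he_conj : ∀ a, starRingEnd ℂ (e a) = e (-a) := fun a => by
    simp [he, ← Complex.exp_conj, Complex.conj_ofNat]
  have he_zero : e 0 = 1 := by simp [he]
  have hmask : ∀ x : 𝔼, maskPoly D x = (1 / (m : ℂ)) * ∑ d : D, e (inner ℝ x (intVec d.1)) := by
    intro x
    rw [maskPoly, hD, ← Finset.sum_coe_sort]
  obtain ⟨A, hA⟩ : ∃ A : Matrix (Fin m) D ℂ,
      ∀ j d, A j d = e (inner ℝ (((j : ℝ) / m) • intVec ν) (intVec d.1)) :=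
    ⟨Matrix.of fun j d => e (inner ℝ (((j : ℝ) / m) • intVec ν) (intVec d.1)), fun _ _ => rfl⟩
  have hcard : Fintype.card (Fin m) = Fintype.card D := by simp [hD]
  have hAA : A * ((1 / (m : ℂ)) • Aᴴ) = 1 := by
    ext j k
    have hjk : (A * ((1 / (m : ℂ)) • Aᴴ)) j k =
        maskPoly D ((((j : ℝ) - (k : ℝ)) / m) • intVec ν) := by
      rw [hmask, Matrix.mul_apply, Finset.mul_sum]
      refine Finset.sum_congr rfl fun d _ => ?_
      rw [Matrix.smul_apply, Matrix.conjTranspose_apply, RCLike.star_def, smul_eq_mul, hA, hA,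
        he_conj, mul_left_comm, ← he_add]
      congr 2
      rw [sub_div, sub_smul, inner_sub_left, sub_eq_add_neg]
    rw [hjk]
    rcases lt_trichotomy j k with h | h | h
    · rw [Matrix.one_apply_ne h.ne]
      have h1 := hzero ((k : ℕ) - j) (by have : (j : ℕ) < k := h; omega) (by omega)
      rw [Nat.cast_sub (le_of_lt h)] at h1
      have h2 := maskPoly_neg D ((((k : ℝ) - (j : ℝ)) / m) • intVec ν)
      rw [h1, map_zero, ← neg_smul, ← neg_div, neg_sub] at h2
      exact h2
    · subst h
      rw [Matrix.one_apply_eq, sub_self, zero_div, zero_smul, hmask]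
      simp [he_zero, hD, hmC]
    · rw [Matrix.one_apply_ne h.ne']
      have h1 := hzero ((j : ℕ) - k) (by have : (k : ℕ) < j := h; omega) (by omega)
      rw [Nat.cast_sub (le_of_lt h)] at h1
      exact h1
  have hBA := (Matrix.mul_eq_one_comm_of_card_eq (Fin m) D ℂ hcard).1 hAA
  let v : D → ℂ := fun d => e (inner ℝ ξ (intVec d.1))
  have hAv : ∀ j : Fin m, maskPoly D (ξ + ((j : ℝ) / m) • intVec ν) = (1 / (m : ℂ)) * (A *ᵥ v) j := by
    intro j
    rw [hmask, Matrix.mulVec, dotProduct]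
    congr 1
    refine Finset.sum_congr rfl fun d _ => ?_
    rw [hA, ← he_add, inner_add_left, add_comm]
  have hvv : star v ⬝ᵥ v = (m : ℂ) := by
    rw [dotProduct]
    have : ∀ d : D, star v d * v d = 1 := by
      intro d
      simp only [v, Pi.star_apply, RCLike.star_def]
      rw [he_conj, ← he_add, neg_add_cancel, he_zero]
    rw [Finset.sum_congr rfl fun d _ => this d]
    simp [hD]
  have hself : star (A *ᵥ v) ⬝ᵥ (A *ᵥ v) = (m : ℂ) * m := by
    rw [Matrix.star_mulVec, ← Matrix.dotProduct_mulVec, Matrix.mulVec_mulVec]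
    have : Aᴴ * A = (m : ℂ) • (1 : Matrix D D ℂ) := by
      rw [← hBA, Matrix.smul_mul, smul_smul, mul_one_div_cancel hmC, one_smul]
    rw [this, Matrix.smul_mulVec, Matrix.one_mulVec, dotProduct_smul, hvv, smul_eq_mul]
  rw [← Fin.sum_univ_eq_sum_range
    (fun j => ‖maskPoly D (ξ + ((j : ℝ) / m) • intVec ν)‖ ^ 2)]
  have hC : ((∑ j : Fin m, ‖maskPoly D (ξ + ((j : ℝ) / m) • intVec ν)‖ ^ 2 : ℝ) : ℂ) = 1 := by
    push_cast
    have : ∀ j : Fin m, ((‖maskPoly D (ξ + ((j : ℝ) / m) • intVec ν)‖ : ℂ)) ^ 2 =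
        (1 / (m : ℂ)) * (1 / (m : ℂ)) * (star (A *ᵥ v) j * (A *ᵥ v) j) := by
      intro j
      rw [← Complex.conj_mul', hAv, map_mul, Pi.star_apply, RCLike.star_def]
      simp only [map_div₀, map_one, Complex.conj_natCast]
      ring
    simp_rw [this, ← Finset.mul_sum]
    have h3 : ∑ j, star (A *ᵥ v) j * (A *ᵥ v) j = (m : ℂ) * m := hself
    rw [h3]
    field_simp
  exact_mod_cast hC

variable (n) in
/-- The lattice `ℤⁿ` in Euclidean space. -/
def intLattice : AddSubgroup (EuclideanSpace ℝ (Fin n)) where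
  carrier := Set.range intVec
  zero_mem' := ⟨0, intVec_zero⟩
  add_mem' := by
    rintro _ _ ⟨a, rfl⟩ ⟨b, rfl⟩
    exact ⟨a + b, intVec_add a b⟩
  neg_mem' := by
    rintro _ ⟨a, rfl⟩
    exact ⟨-a, by ext i; simp [intVec_apply]⟩

theorem addOrderOf_mk_smul_intVec (hm : m.Prime) (hn : 0 < n)
    (hν : ∀ i, 1 ≤ ν i ∧ ν i ≤ (m : ℤ) - 1) :
    addOrderOf (((1 / (m : ℝ)) • intVec ν : 𝔼) : 𝔼 ⧸ intLattice n) = m := by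
  have := Fact.mk hm
  have hm0 : (m : ℝ) ≠ 0 := by exact_mod_cast hm.ne_zero
  refine addOrderOf_eq_prime ?_ ?_
  · rw [← QuotientAddGroup.mk_nsmul, QuotientAddGroup.eq_zero_iff]
    refine ⟨ν, ?_⟩
    rw [← Nat.cast_smul_eq_nsmul ℝ, smul_smul, mul_one_div_cancel hm0, one_smul]
  · rw [Ne, QuotientAddGroup.eq_zero_iff]
    rintro ⟨z, hz⟩
    have h1 := congrArg (fun x : 𝔼 => x ⟨0, hn⟩) hz
    simp only [intVec_apply, PiLp.smul_apply, smul_eq_mul] at h1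
    have h2 : (z ⟨0, hn⟩ * m : ℝ) = ν ⟨0, hn⟩ := by rw [h1]; field_simp
    have h3 : z ⟨0, hn⟩ * (m : ℤ) = ν ⟨0, hn⟩ := by exact_mod_cast h2
    have h4 := hν ⟨0, hn⟩
    have h5 : z ⟨0, hn⟩ ≤ 0 ∨ 1 ≤ z ⟨0, hn⟩ := by omega
    have hmp : (0 : ℤ) < m := by exact_mod_cast hm.pos
    rcases h5 with h5 | h5 <;> nlinarith

theorem mk_mem_zmultiples_of_maskPoly_eq_zero (hzero : maskZeros D = latticeCosets m ν) {x : 𝔼}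
    (hx : maskPoly D x = 0) :
    (x : 𝔼 ⧸ intLattice n) ∈
      AddSubgroup.zmultiples (((1 / (m : ℝ)) • intVec ν : 𝔼) : 𝔼 ⧸ intLattice n) := by
  have hx' : x ∈ maskZeros D := hx
  rw [hzero] at hx'
  obtain ⟨j, -, -, z, rfl⟩ := hx'
  have h0 : ((intVec z : 𝔼) : 𝔼 ⧸ intLattice n) = 0 :=
    (QuotientAddGroup.eq_zero_iff _).2 ⟨z, rfl⟩
  have h1 : ((j : ℝ) / m) • intVec ν = j • ((1 / (m : ℝ)) • intVec ν : 𝔼) := by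
    rw [← Nat.cast_smul_eq_nsmul ℝ, smul_smul, mul_one_div]
  rw [QuotientAddGroup.mk_add, h0, add_zero, h1, QuotientAddGroup.mk_nsmul]
  exact AddSubgroup.nsmul_mem_zmultiples _ _

theorem maskPoly_zero (hD : 0 < D.card) : maskPoly D 0 = 1 := by
  have : (D.card : ℂ) ≠ 0 := by exact_mod_cast hD.ne'
  simp [maskPoly, this]

theorem maskPoly_ne_zero_of_mem (hD : 0 < D.card) {x : 𝔼} (hx : x ∈ intLattice n) :
    maskPoly D x ≠ 0 := by
  obtain ⟨z, rfl⟩ := hx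
  rw [← zero_add (intVec z), maskPoly_add_intVec, maskPoly_zero hD]
  exact one_ne_zero

end Mask

section Convolution

variable {n m : ℕ} {R : ℕ → Matrix (Fin n) (Fin n) ℤ} {D : ℕ → Finset (Fin n → ℤ)}

local notation "𝔼" => EuclideanSpace ℝ (Fin n)

theorem euclMap_mul (A B : Matrix (Fin n) (Fin n) ℝ) : euclMap (A * B) = euclMap A * euclMap B :=
  map_mul _ _ _

theorem euclMap_mul_apply (A B : Matrix (Fin n) (Fin n) ℝ) (x : 𝔼) :
    euclMap (A * B) x = euclMap A (euclMap B x) := by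
  rw [euclMap_mul]; rfl

theorem euclMap_one : euclMap (1 : Matrix (Fin n) (Fin n) ℝ) = 1 := map_one _

theorem euclMap_transpose (A : Matrix (Fin n) (Fin n) ℝ) :
    euclMap Aᵀ = ContinuousLinearMap.adjoint (euclMap A) := by
  rw [← Matrix.conjTranspose_eq_transpose_of_trivial, ← Matrix.star_eq_conjTranspose]
  exact map_star _ _

theorem norm_euclMap_transpose (A : Matrix (Fin n) (Fin n) ℝ) : ‖euclMap Aᵀ‖ = ‖euclMap A‖ := by
  rw [euclMap_transpose]
  exact LinearIsometryEquiv.norm_map _ _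

theorem inner_euclMap (A : Matrix (Fin n) (Fin n) ℝ) (x y : 𝔼) :
    inner ℝ x (euclMap A y) = inner ℝ (euclMap Aᵀ x) y := by
  rw [euclMap_transpose, ContinuousLinearMap.adjoint_inner_left]

theorem det_realMat_ne_zero {A : Matrix (Fin n) (Fin n) ℤ} (hA : IsExpanding A) :
    (realMat A).det ≠ 0 := by
  intro h
  have h1 : (A.map fun a => (a : ℂ)).det = 0 := by
    have h2 : ((A.det : ℤ) : ℝ) = (realMat A).det := (Int.castRingHom ℝ).map_det A
    have h3 : ((A.det : ℤ) : ℂ) = (A.map fun a => (a : ℂ)).det := (Int.castRingHom ℂ).map_det A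
    rw [h] at h2
    rw [← h3]
    exact_mod_cast h2
  have h0 : (0 : ℂ) ∈ spectrum ℂ (A.map fun a => (a : ℂ)) := by
    rw [spectrum.zero_mem_iff, Matrix.isUnit_iff_isUnit_det, h1]
    simp
  have := hA 0 h0
  rw [norm_zero] at this
  linarith

/-- The map `x ↦ (R₁⁻¹ ⋯ R_k⁻¹)ᵗ x`. -/
def dualMap (R : ℕ → Matrix (Fin n) (Fin n) ℤ) (k : ℕ) :
    EuclideanSpace ℝ (Fin n) →L[ℝ] EuclideanSpace ℝ (Fin n) :=
  euclMap (invProd R k)ᵀ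

theorem invProd_add (R : ℕ → Matrix (Fin n) (Fin n) ℤ) (k l : ℕ) :
    invProd R (k + l) = invProd R k * invProd (fun i => R (k + i)) l := by
  induction l with
  | zero => simp [invProd]
  | succ l ih => rw [← add_assoc, invProd, ih, invProd, mul_assoc, ← add_assoc]

theorem dualMap_zero (R : ℕ → Matrix (Fin n) (Fin n) ℤ) (x : 𝔼) : dualMap R 0 x = x := by
  simp [dualMap, invProd, euclMap_one]

theorem dualMap_add (R : ℕ → Matrix (Fin n) (Fin n) ℤ) (k l : ℕ) (x : 𝔼) :
    dualMap R (k + l) x = dualMap (fun i => R (k + i)) l (dualMap R k x) := by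
  rw [dualMap, invProd_add, Matrix.transpose_mul, euclMap_mul_apply]
  rfl

theorem norm_dualMap (R : ℕ → Matrix (Fin n) (Fin n) ℤ) (k : ℕ) :
    ‖dualMap R k‖ = ‖euclMap (invProd R k)‖ := norm_euclMap_transpose _

theorem det_invProd_ne_zero (hR : ∀ k ≥ 1, (realMat (R k)).det ≠ 0) (k : ℕ) :
    (invProd R k).det ≠ 0 := by
  induction k with
  | zero => simp [invProd]
  | succ k ih =>
    rw [invProd, Matrix.det_mul, Matrix.det_nonsing_inv]
    rw [Ring.inverse_eq_inv']
    exact mul_ne_zero ih (inv_ne_zero (hR _ (by omega)))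

theorem euclMap_injective {A : Matrix (Fin n) (Fin n) ℝ} (hA : A.det ≠ 0) :
    Function.Injective (euclMap A) := by
  refine Function.LeftInverse.injective (g := euclMap A⁻¹) fun x => ?_
  rw [← euclMap_mul_apply, Matrix.nonsing_inv_mul _ (isUnit_iff_ne_zero.2 hA), euclMap_one]
  rfl

theorem intVec_injective : Function.Injective (intVec : (Fin n → ℤ) → 𝔼) := by
  intro a b h
  ext i
  have := congrArg (fun x : 𝔼 => x i) h
  simpa [intVec_apply] using this

theorem isProbabilityMeasure_uniformMeasure {E : Finset 𝔼} (hE : E.Nonempty) :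
    IsProbabilityMeasure (uniformMeasure E) := by
  constructor
  have : (E.card : ℝ≥0∞) ≠ 0 := by exact_mod_cast hE.card_pos.ne'
  simp [uniformMeasure, ENNReal.inv_mul_cancel this]

theorem isProbabilityMeasure_finiteConv (hD : ∀ k ≥ 1, (D k).Nonempty) (l : ℕ) :
    IsProbabilityMeasure (finiteConv R D l) := by
  induction l with
  | zero => rw [finiteConv]; infer_instance
  | succ l ih =>
    have := isProbabilityMeasure_uniformMeasure (E := scaledDigits R D (l + 1))
      ((hD (l + 1) (by omega)).image _)
    rw [finiteConv]
    infer_instance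

theorem ft_conv (μ ρ : Measure 𝔼) [IsProbabilityMeasure μ] [IsProbabilityMeasure ρ] (ξ : 𝔼) :
    ft (μ.conv ρ) ξ = ft μ ξ * ft ρ ξ := by
  simp only [ft_eq_charFun, charFun_conv]

theorem ft_uniformMeasure_scaledDigits (hR : ∀ k ≥ 1, (realMat (R k)).det ≠ 0) (k : ℕ) (ξ : 𝔼) :
    ft (uniformMeasure (scaledDigits R D k)) ξ = maskPoly (D k) (dualMap R k ξ) := by
  classical
  have hinj : Function.Injective fun d : Fin n → ℤ => euclMap (invProd R k) (intVec d) :=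
    (euclMap_injective (det_invProd_ne_zero hR k)).comp intVec_injective
  rw [ft, uniformMeasure, integral_smul_measure, integral_finsetSum_measure]
  · rw [scaledDigits, maskPoly]
    rw [Finset.card_image_of_injective _ (by convert hinj), Finset.sum_image (by
      intro a _ b _ h; exact hinj h)]
    simp only [integral_dirac, dualMap, inner_euclMap]
    simp
  · intro a _
    exact integrable_dirac (by simp)

theorem ft_finiteConv (hR : ∀ k ≥ 1, (realMat (R k)).det ≠ 0) (hD : ∀ k ≥ 1, (D k).Nonempty)
    (l : ℕ) (ξ : 𝔼) : ft (finiteConv R D l) ξ =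
      ∏ j ∈ Finset.range l, maskPoly (D (j + 1)) (dualMap R (j + 1) ξ) := by
  induction l with
  | zero => simp [finiteConv, ft_eq_charFun, charFun_dirac]
  | succ l ih =>
    have := isProbabilityMeasure_uniformMeasure (E := scaledDigits R D (l + 1))
      ((hD (l + 1) (by omega)).image _)
    have := isProbabilityMeasure_finiteConv (R := R) hD l
    rw [finiteConv, ft_conv, ih, ft_uniformMeasure_scaledDigits hR, Finset.prod_range_succ]

theorem ft_finiteConv_add (hR : ∀ k ≥ 1, (realMat (R k)).det ≠ 0) (hD : ∀ k ≥ 1, (D k).Nonempty)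
    (k l : ℕ) (ξ : 𝔼) : ft (finiteConv R D (k + l)) ξ = ft (finiteConv R D k) ξ *
      ft (finiteConv (fun i => R (k + i)) (fun i => D (k + i)) l) (dualMap R k ξ) := by
  rw [ft_finiteConv hR hD, ft_finiteConv hR hD, ft_finiteConv (fun j hj => hR (k + j) (by omega))
    (fun j hj => hD (k + j) (by omega)), Finset.prod_range_add]
  congr 1
  refine Finset.prod_congr rfl fun j _ => ?_
  rw [add_assoc, dualMap_add]

theorem finiteConv_ball_compl {C : ℝ} (hC : ∀ k ≥ 1, ∀ d ∈ D k, ‖intVec d‖ ≤ C)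
    (hD : ∀ k ≥ 1, (D k).Nonempty) (l : ℕ) :
    ∀ᵐ x ∂(finiteConv R D l),
      ‖x‖ ≤ ∑ j ∈ Finset.range l, ‖euclMap (invProd R (j + 1))‖ * C := by
  induction l with
  | zero => simp [finiteConv]
  | succ l ih =>
    have := isProbabilityMeasure_uniformMeasure (E := scaledDigits R D (l + 1))
      ((hD (l + 1) (by omega)).image _)
    have := isProbabilityMeasure_finiteConv (R := R) hD l
    have hu : ∀ᵐ x ∂(uniformMeasure (scaledDigits R D (l + 1))),
        ‖x‖ ≤ ‖euclMap (invProd R (l + 1))‖ * C := by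
      refine Measure.ae_smul_measure ?_ _
      rw [ae_finsetSum_measure_iff]
      intro a ha
      rw [ae_dirac_eq]
      classical
      obtain ⟨d, hd, rfl⟩ := Finset.mem_image.1 ha
      refine ((euclMap _).le_opNorm _).trans ?_
      gcongr
      exact hC _ (by omega) d hd
    rw [finiteConv, Measure.conv, ae_map_iff (by fun_prop)
      (measurableSet_le (by fun_prop) (by fun_prop)), Finset.sum_range_succ]
    filter_upwards [Measure.quasiMeasurePreserving_fst.ae ih,
      Measure.quasiMeasurePreserving_snd.ae hu] with x hx1 hx2
    exact (norm_add_le _ _).trans (add_le_add hx1 hx2)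

/-- The norm of `R₁⁻¹ ⋯ R_l⁻¹` decays at least geometrically. -/
def GeomDecay (R : ℕ → Matrix (Fin n) (Fin n) ℤ) (B r : ℝ) : Prop :=
  ∀ l, ‖euclMap (invProd R l)‖ ≤ B * r ^ l

theorem exists_geomDecay
    (hRlim : limsup (fun k => ‖euclMap ((realMat (R k))⁻¹)‖ₑ) atTop < 1) :
    ∃ r : ℝ, 0 < r ∧ r < 1 ∧ (∃ K, ∀ k ≥ K, GeomDecay (fun i => R (k + i)) 1 r) ∧
      ∀ k, ∃ B, GeomDecay (fun i => R (k + i)) B r := by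
  obtain ⟨b, hb1, hb2⟩ := exists_between hRlim
  obtain ⟨K, hK⟩ := eventually_atTop.1 (eventually_lt_of_limsup_lt hb1)
  have hr1 : max b.toReal (1 / 2) < 1 := by
    refine max_lt ?_ (by norm_num)
    have := ENNReal.toReal_strict_mono ENNReal.one_ne_top hb2
    simpa using this
  set r := max b.toReal (1 / 2) with hr
  have hr0 : 0 < r := lt_of_lt_of_le (by norm_num) (le_max_right _ _)
  have hKr : ∀ k ≥ K, ‖euclMap ((realMat (R k))⁻¹)‖ ≤ r := by
    intro k hk
    refine le_trans ?_ (le_max_left _ _)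
    have := ENNReal.toReal_mono hb2.ne_top (hK k hk).le
    simpa using this
  have h1 : ‖euclMap (1 : Matrix (Fin n) (Fin n) ℝ)‖ ≤ 1 := by
    rw [euclMap_one]; exact ContinuousLinearMap.norm_id_le
  have hlarge : ∀ k ≥ K, GeomDecay (fun i => R (k + i)) 1 r := by
    intro k hk l
    induction l with
    | zero => simpa [invProd] using h1
    | succ l ih =>
      rw [invProd, euclMap_mul]
      refine (norm_mul_le _ _).trans ?_
      rw [pow_succ, ← mul_assoc]
      exact mul_le_mul ih (hKr _ (by omega)) (norm_nonneg _) (by positivity)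
  refine ⟨r, hr0, hr1, ⟨K, hlarge⟩, fun k => ?_⟩
  rcases le_total K k with hk | hk
  · exact ⟨1, hlarge k hk⟩
  refine Nat.decreasingInduction (motive := fun k _ => ∃ B, GeomDecay (fun i => R (k + i)) B r)
    (fun k _ ih => ?_) ⟨1, hlarge K le_rfl⟩ hk
  obtain ⟨B, hB⟩ := ih
  set c := ‖euclMap (invProd (fun i => R (k + i)) 1)‖ with hc
  have hB0 : 0 ≤ B := by simpa using (norm_nonneg _).trans (hB 0)
  refine ⟨1 + c * B / r, fun l => ?_⟩
  cases l with
  | zero =>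
    have : 0 ≤ c * B / r := by positivity
    simp only [invProd, pow_zero, mul_one]
    linarith
  | succ l =>
    rw [add_comm l 1, invProd_add, euclMap_mul]
    refine (norm_mul_le _ _).trans ?_
    have h2 : ‖euclMap (invProd (fun i => R (k + (1 + i))) l)‖ ≤ B * r ^ l := by
      have := hB l
      simpa only [add_assoc] using this
    calc _ ≤ c * (B * r ^ l) := by gcongr
      _ = (c * B / r) * r ^ (1 + l) := by rw [pow_add]; field_simp
      _ ≤ (1 + c * B / r) * r ^ (1 + l) := by gcongr; linarith

theorem ae_norm_le_finiteConv {B r C : ℝ} (hr0 : 0 < r) (hr1 : r < 1) (hgeo : GeomDecay R B r)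
    (hC : ∀ k ≥ 1, ∀ d ∈ D k, ‖intVec d‖ ≤ C) (hD : ∀ k ≥ 1, (D k).Nonempty) (l : ℕ) :
    ∀ᵐ x ∂(finiteConv R D l), ‖x‖ ≤ B * C * (1 - r)⁻¹ := by
  have hC0 : 0 ≤ C := by
    obtain ⟨d, hd⟩ := hD 1 le_rfl
    exact (norm_nonneg _).trans (hC 1 le_rfl d hd)
  have hB0 : 0 ≤ B := by simpa using (norm_nonneg _).trans (hgeo 0)
  filter_upwards [finiteConv_ball_compl (R := R) hC hD l] with x hx
  refine hx.trans ?_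
  have h1 : ∀ j ∈ Finset.range l, ‖euclMap (invProd R (j + 1))‖ * C ≤ B * C * r ^ j := by
    intro j _
    calc _ ≤ B * r ^ (j + 1) * C := by gcongr; exact hgeo _
      _ = B * C * r ^ j * r := by ring
      _ ≤ B * C * r ^ j * 1 := by gcongr
      _ = _ := by ring
  refine (Finset.sum_le_sum h1).trans ?_
  rw [← Finset.mul_sum]
  gcongr
  rw [← tsum_geometric_of_lt_one hr0.le hr1]
  exact (summable_geometric_of_lt_one hr0.le hr1).sum_le_tsum _ fun _ _ => by positivity

theorem norm_char_sub_one_le (a : ℝ) :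
    ‖Complex.exp (2 * Real.pi * Complex.I * (a : ℝ)) - 1‖ ≤ 2 * Real.pi * |a| := by
  have h := Real.norm_exp_I_mul_ofReal_sub_one_le (x := 2 * Real.pi * a)
  have h2 : Complex.I * ((2 * Real.pi * a : ℝ) : ℂ) = 2 * Real.pi * Complex.I * (a : ℝ) := by
    push_cast; ring
  rw [h2, Real.norm_eq_abs, abs_mul, abs_of_pos (by positivity : 0 < 2 * Real.pi)] at h
  exact h

theorem norm_ft_sub_one_le {μ : Measure 𝔼} [IsProbabilityMeasure μ] {ρ : ℝ}
    (hμ : ∀ᵐ x ∂μ, ‖x‖ ≤ ρ) (ξ : 𝔼) : ‖ft μ ξ - 1‖ ≤ 2 * Real.pi * (ρ * ‖ξ‖) := by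
  have h1 : ft μ ξ - 1 =
      ∫ x, (Complex.exp (2 * Real.pi * Complex.I * (inner ℝ ξ x : ℝ)) - 1) ∂μ := by
    rw [integral_sub ((memLp_char μ ξ).integrable (by norm_num)) (integrable_const _), ft]
    simp
  rw [h1]
  have := norm_integral_le_of_norm_le_const (μ := μ) (C := 2 * Real.pi * (ρ * ‖ξ‖))
    (f := fun x => Complex.exp (2 * Real.pi * Complex.I * (inner ℝ ξ x : ℝ)) - 1) (by
      filter_upwards [hμ] with x hx
      refine (norm_char_sub_one_le _).trans ?_
      gcongr
      refine (abs_real_inner_le_norm _ _).trans ?_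
      rw [mul_comm]
      gcongr)
  simpa using this

theorem norm_maskPoly_sub_one_le {D : Finset (Fin n → ℤ)} (hD : D.Nonempty) {C : ℝ}
    (hC : ∀ d ∈ D, ‖intVec d‖ ≤ C) (ξ : 𝔼) :
    ‖maskPoly D ξ - 1‖ ≤ 2 * Real.pi * (C * ‖ξ‖) := by
  have hcard : (D.card : ℂ) ≠ 0 := by exact_mod_cast hD.card_pos.ne'
  have hcard' : (0 : ℝ) < D.card := by exact_mod_cast hD.card_pos
  have h1 : maskPoly D ξ - 1 = (1 / (D.card : ℂ)) * ∑ d ∈ D,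
      (Complex.exp (2 * Real.pi * Complex.I * (inner ℝ ξ (intVec d) : ℝ)) - 1) := by
    rw [Finset.sum_sub_distrib, mul_sub, maskPoly]
    simp [hcard]
  rw [h1, norm_mul, norm_div, norm_one, Complex.norm_natCast, one_div, inv_mul_le_iff₀ hcard']
  refine (norm_sum_le _ _).trans ?_
  rw [← nsmul_eq_mul]
  refine Finset.sum_le_card_nsmul _ _ _ fun d hd => ?_
  refine (norm_char_sub_one_le _).trans ?_
  gcongr
  refine (abs_real_inner_le_norm _ _).trans ?_
  rw [mul_comm]
  gcongr
  exact hC d hd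

/-- The finite convolutions, as probability measures. -/
def probConv (R : ℕ → Matrix (Fin n) (Fin n) ℤ) (hD : ∀ k ≥ 1, (D k).Nonempty) (l : ℕ) :
    ProbabilityMeasure (EuclideanSpace ℝ (Fin n)) :=
  ⟨finiteConv R D l, isProbabilityMeasure_finiteConv hD l⟩

theorem isMoranMeasure_iff (hD : ∀ k ≥ 1, (D k).Nonempty) (μ : ProbabilityMeasure 𝔼) :
    IsMoranMeasure R D μ ↔ Tendsto (probConv R hD) atTop (𝓝 μ) := by
  rw [ProbabilityMeasure.tendsto_iff_forall_integral_tendsto]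
  exact ⟨fun h => h.2, fun h => ⟨μ.2, h⟩⟩

theorem IsMoranMeasure.tendsto_ft (hD : ∀ k ≥ 1, (D k).Nonempty) {μ : Measure 𝔼}
    (hμ : IsMoranMeasure R D μ) (ξ : 𝔼) :
    Tendsto (fun l => ft (finiteConv R D l) ξ) atTop (𝓝 (ft μ ξ)) := by
  obtain ⟨μ, rfl⟩ : ∃ μ' : ProbabilityMeasure 𝔼, (μ' : Measure 𝔼) = μ := ⟨⟨μ, hμ.1⟩, rfl⟩
  have := (isMoranMeasure_iff hD μ).1 hμ
  rw [ProbabilityMeasure.tendsto_iff_tendsto_charFun] at this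
  simp only [ft_eq_charFun]
  exact this _

theorem isMoranMeasure_of_tendsto_ft (hD : ∀ k ≥ 1, (D k).Nonempty) {μ : Measure 𝔼}
    [hμ : IsProbabilityMeasure μ]
    (h : ∀ ξ, Tendsto (fun l => ft (finiteConv R D l) ξ) atTop (𝓝 (ft μ ξ))) :
    IsMoranMeasure R D μ := by
  obtain ⟨μ, rfl⟩ : ∃ μ' : ProbabilityMeasure 𝔼, (μ' : Measure 𝔼) = μ := ⟨⟨μ, hμ⟩, rfl⟩
  refine (isMoranMeasure_iff hD μ).2 ?_
  rw [ProbabilityMeasure.tendsto_iff_tendsto_charFun]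
  intro t
  have := h ((2 * Real.pi)⁻¹ • t)
  simp only [ft_eq_charFun, smul_smul] at this
  rw [mul_inv_cancel₀ (by positivity), one_smul] at this
  exact this

theorem IsMoranMeasure.ae_norm_le {B r C : ℝ} (hr0 : 0 < r) (hr1 : r < 1)
    (hgeo : GeomDecay R B r) (hC : ∀ k ≥ 1, ∀ d ∈ D k, ‖intVec d‖ ≤ C)
    (hD : ∀ k ≥ 1, (D k).Nonempty) {μ : Measure 𝔼} (hμ : IsMoranMeasure R D μ) :
    ∀ᵐ x ∂μ, ‖x‖ ≤ B * C * (1 - r)⁻¹ := by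
  obtain ⟨μ, rfl⟩ : ∃ μ' : ProbabilityMeasure 𝔼, (μ' : Measure 𝔼) = μ := ⟨⟨μ, hμ.1⟩, rfl⟩
  have h := (isMoranMeasure_iff hD μ).1 hμ
  have hopen : IsOpen {x : 𝔼 | ¬ ‖x‖ ≤ B * C * (1 - r)⁻¹} := by
    simp only [not_le]
    exact isOpen_lt continuous_const continuous_norm
  have h1 := ProbabilityMeasure.le_liminf_measure_open_of_tendsto h hopen
  rw [ae_iff]
  refine le_antisymm (h1.trans (le_of_eq ?_)) zero_le
  have h2 : ∀ l, (probConv R hD l : Measure 𝔼) {x : 𝔼 | ¬ ‖x‖ ≤ B * C * (1 - r)⁻¹} = 0 := fun l =>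
    ae_iff.1 (ae_norm_le_finiteConv hr0 hr1 hgeo hC hD l)
  simp only [h2]
  simp

theorem exists_isMoranMeasure {B r C : ℝ} (hr0 : 0 < r) (hr1 : r < 1)
    (hgeo : GeomDecay R B r) (hR : ∀ k ≥ 1, (realMat (R k)).det ≠ 0)
    (hC : ∀ k ≥ 1, ∀ d ∈ D k, ‖intVec d‖ ≤ C)
    (hD : ∀ k ≥ 1, (D k).Nonempty) : ∃ μ : Measure 𝔼, IsMoranMeasure R D μ := by
  have hC0 : 0 ≤ C := by
    obtain ⟨d, hd⟩ := hD 1 le_rfl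
    exact (norm_nonneg _).trans (hC 1 le_rfl d hd)
  have hprob := isProbabilityMeasure_finiteConv (R := R) hD
  have hcauchy : ∀ ξ : 𝔼, CauchySeq fun l => ft (finiteConv R D l) ξ := by
    intro ξ
    refine cauchySeq_of_le_geometric r (2 * Real.pi * (C * (B * r * ‖ξ‖))) hr1 fun l => ?_
    rw [dist_comm, dist_eq_norm, ft_finiteConv hR hD, ft_finiteConv hR hD, Finset.prod_range_succ,
      ← ft_finiteConv hR hD, ← mul_sub_one, norm_mul]
    have h1 := norm_maskPoly_sub_one_le (hD (l + 1) (by omega)) (hC (l + 1) (by omega))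
      (dualMap R (l + 1) ξ)
    have h2 : ‖dualMap R (l + 1) ξ‖ ≤ B * r ^ (l + 1) * ‖ξ‖ := by
      refine ((dualMap R (l + 1)).le_opNorm _).trans ?_
      gcongr
      rw [norm_dualMap]
      exact hgeo _
    calc _ ≤ 1 * (2 * Real.pi * (C * ‖dualMap R (l + 1) ξ‖)) :=
          mul_le_mul (norm_ft_le_one _ _) h1 (norm_nonneg _) zero_le_one
      _ ≤ 1 * (2 * Real.pi * (C * (B * r ^ (l + 1) * ‖ξ‖))) := by gcongr
      _ = _ := by ring
  have htight : IsTightMeasureSet {((μ : ProbabilityMeasure 𝔼) : Measure 𝔼) | μ ∈ Set.range (probConv R hD)} := by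
    rw [isTightMeasureSet_iff_exists_isCompact_measure_compl_le]
    intro ε _
    refine ⟨Metric.closedBall 0 (B * C * (1 - r)⁻¹), isCompact_closedBall _ _, ?_⟩
    rintro _ ⟨_, ⟨l, rfl⟩, rfl⟩
    have := ae_iff.1 (ae_norm_le_finiteConv hr0 hr1 hgeo hC hD l)
    refine le_of_eq_of_le ?_ zero_le
    rw [← this]
    congr 1
    ext x
    simp
  have hcomp := isCompact_closure_of_isTightMeasureSet htight
  rw [isCompact_iff_ultrafilter_le_nhds] at hcomp
  obtain ⟨μ, -, hμ⟩ := hcomp ((hyperfilter ℕ).map (probConv R hD)) (by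
    rw [le_principal_iff]
    exact Filter.mem_of_superset Filter.range_mem_map subset_closure)
  refine ⟨μ, isMoranMeasure_of_tendsto_ft hD fun ξ => ?_⟩
  obtain ⟨z, hz⟩ := cauchySeq_tendsto_of_complete (hcauchy ξ)
  have hη : Tendsto (probConv R hD) (hyperfilter ℕ) (𝓝 μ) := hμ
  have h1 : Tendsto (fun l => ft (finiteConv R D l) ξ) (hyperfilter ℕ) (𝓝 (ft μ ξ)) := by
    rw [ProbabilityMeasure.tendsto_iff_forall_integral_rclike_tendsto ℂ] at hη
    simp only [ft_eq_charFun, charFun_eq_integral_innerProbChar]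
    exact hη _
  have h2 := hz.mono_left (Nat.hyperfilter_le_atTop)
  rw [tendsto_nhds_unique h1 h2]
  exact hz

theorem IsMoranMeasure.ft_eq_mul (hR : ∀ k ≥ 1, (realMat (R k)).det ≠ 0)
    (hD : ∀ k ≥ 1, (D k).Nonempty) {μ σ : Measure 𝔼} (hμ : IsMoranMeasure R D μ) (k : ℕ)
    (hσ : IsMoranMeasure (fun i => R (k + i)) (fun i => D (k + i)) σ) (ξ : 𝔼) :
    ft μ ξ = ft (finiteConv R D k) ξ * ft σ (dualMap R k ξ) := by
  have h1 := (tendsto_add_atTop_iff_nat k).2 (hμ.tendsto_ft hD ξ)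
  have h2 := (hσ.tendsto_ft (fun j hj => hD (k + j) (by omega)) (dualMap R k ξ)).const_mul
    (ft (finiteConv R D k) ξ)
  refine tendsto_nhds_unique h1 (h2.congr fun l => ?_)
  rw [add_comm l k, ft_finiteConv_add hR hD]

end Convolution

section Necessity

variable {n m : ℕ}

local notation "𝔼" => EuclideanSpace ℝ (Fin n)

theorem IsSpectrum.nonempty {μ : Measure 𝔼} [IsProbabilityMeasure μ] {Λ : Set 𝔼}
    (h : IsSpectrum μ Λ) : Λ.Nonempty := by
  rw [Set.nonempty_iff_ne_empty]
  rintro rfl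
  have := (h.hasSum 0).tsum_eq
  simp at this

theorem ft_map (μ : Measure 𝔼) (A : Matrix (Fin n) (Fin n) ℝ) (ξ : 𝔼) :
    ft (μ.map (euclMap A)) ξ = ft μ (euclMap Aᵀ ξ) := by
  rw [ft, ft, integral_map (by fun_prop) (by fun_prop)]
  simp only [inner_euclMap]

theorem euclMap_inv_apply {A : Matrix (Fin n) (Fin n) ℝ} (hA : A.det ≠ 0) (x : 𝔼) :
    euclMap A (euclMap A⁻¹ x) = x := by
  rw [← euclMap_mul_apply, Matrix.mul_nonsing_inv _ (isUnit_iff_ne_zero.2 hA), euclMap_one]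
  rfl

theorem IsSpectrum.map {μ : Measure 𝔼} [IsProbabilityMeasure μ] {Λ : Set 𝔼}
    (h : IsSpectrum μ Λ) {A : Matrix (Fin n) (Fin n) ℝ} (hA : A.det ≠ 0) :
    IsSpectrum (μ.map (euclMap A)) (euclMap Aᵀ ⁻¹' Λ) := by
  have : IsProbabilityMeasure (μ.map (euclMap A)) :=
    Measure.isProbabilityMeasure_map (by fun_prop)
  have hAt : Aᵀ.det ≠ 0 := by rwa [Matrix.det_transpose]
  have hinj := euclMap_injective hAt
  have hsurj : Function.Surjective (euclMap Aᵀ) := fun x => ⟨_, euclMap_inv_apply hAt x⟩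
  refine isSpectrum_of_hasSum (h.1.preimage hinj) fun ξ => ?_
  let e : (euclMap Aᵀ ⁻¹' Λ) ≃ Λ :=
    (Equiv.ofBijective _ ⟨hinj, hsurj⟩).subtypeEquiv fun _ => Iff.rfl
  have h1 := (e.hasSum_iff).2 (h.hasSum (euclMap Aᵀ ξ))
  convert h1 using 2 with l
  rw [ft_map, map_add]
  rfl

variable {D : Finset (Fin n → ℤ)} {ν : Fin n → ℤ}

theorem countable_zmultiples_preimage (g : 𝔼) :
    {x : 𝔼 | (x : 𝔼 ⧸ intLattice n) ∈
      AddSubgroup.zmultiples (g : 𝔼 ⧸ intLattice n)}.Countable := by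
  refine (Set.countable_range fun p : ℤ × (Fin n → ℤ) => p.1 • g + intVec p.2).mono ?_
  rintro x ⟨k, hk⟩
  have hk' : ((k • g : 𝔼) : 𝔼 ⧸ intLattice n) = x := hk
  rw [QuotientAddGroup.eq] at hk'
  obtain ⟨z, hz⟩ := hk'
  exact ⟨(k, z), by simp only [hz]; abel⟩

theorem hasSum_ofReal_tsum {ι : Type*} {f : ι → ℝ} {a : ℝ} (hf : ∀ i, 0 ≤ f i) (h : HasSum f a) :
    ∑' i, ENNReal.ofReal (f i) = ENNReal.ofReal a := by
  rw [← ENNReal.ofReal_tsum_of_nonneg hf h.summable, h.tsum_eq]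

theorem selected_orthogonal {V : Type*} [AddCommGroup V] {Z : AddSubgroup V} {g : V} {Λ : Set V}
    {s : (V ⧸ Z) ⧸ AddSubgroup.zmultiples (g : V ⧸ Z) → V ⧸ Z} {a b : V}
    (ha : a ∈ selected Z g Λ s) (hb : b ∈ selected Z g Λ s)
    (hab : ((a - b : V) : V ⧸ Z) ∈ AddSubgroup.zmultiples (g : V ⧸ Z)) :
    (a : V ⧸ Z) = b := by
  rw [← ha.2, ← hb.2]
  congr 1
  rw [eq_comm, QuotientAddGroup.eq, neg_add_eq_sub]
  exact hab

theorem cosetSum_add_eq_and_tsum_selected_ft (hm : m.Prime) (hn : 0 < n) (hD : D.card = m)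
    (hν : ∀ i, 1 ≤ ν i ∧ ν i ≤ (m : ℤ) - 1) (hzero : maskZeros D = latticeCosets m ν)
    {ρ σ : Measure 𝔼} [IsProbabilityMeasure ρ] [IsProbabilityMeasure σ]
    (hft : ∀ x, ft ρ x = maskPoly D x * ft σ x) {Λ : Set 𝔼} (hΛ : IsSpectrum ρ Λ) {g : 𝔼}
    (hg : g = (1 / (m : ℝ)) • intVec ν)
    (horth : ∀ s, ∀ a ∈ selected (intLattice n) g Λ s, ∀ b ∈ selected (intLattice n) g Λ s,
      a ≠ b → ft σ (a - b) = 0) {ξ : 𝔼}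
    (hξ : ∀ l ∈ Λ, ((ξ + l : 𝔼) : 𝔼 ⧸ intLattice n) ∉
      AddSubgroup.zmultiples (g : 𝔼 ⧸ intLattice n)) :
    (∀ κ κ' : 𝔼 ⧸ intLattice n, κ - κ' ∈ AddSubgroup.zmultiples (g : 𝔼 ⧸ intLattice n) →
      cosetSum Λ (fun l => ENNReal.ofReal (‖ft σ (ξ + l)‖ ^ 2)) κ =
        cosetSum Λ (fun l => ENNReal.ofReal (‖ft σ (ξ + l)‖ ^ 2)) κ') ∧
    ∀ s, (∀ i, QuotientAddGroup.mk (s i) = i) →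
      ∑' l : selected (intLattice n) g Λ s, ‖ft σ (ξ + l)‖ ^ 2 = 1 := by
  have hgo : addOrderOf (g : 𝔼 ⧸ intLattice n) = m := by
    rw [hg]; exact addOrderOf_mk_smul_intVec hm hn hν
  have hzeros : ∀ x : 𝔼, maskPoly D x = 0 → (x : 𝔼 ⧸ intLattice n) ∈
      AddSubgroup.zmultiples (g : 𝔼 ⧸ intLattice n) := fun x hx => by
    rw [hg]; exact mk_mem_zmultiples_of_maskPoly_eq_zero hzero hx
  let p : 𝔼 ⧸ intLattice n → ℝ≥0∞ := fun κ => ENNReal.ofReal (‖maskPoly D (ξ + κ.out)‖ ^ 2)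
  have hpmk : ∀ x : 𝔼, p (x : 𝔼 ⧸ intLattice n) = ENNReal.ofReal (‖maskPoly D (ξ + x)‖ ^ 2) := by
    intro x
    have h1 : ((Quotient.out (x : 𝔼 ⧸ intLattice n) : 𝔼) : 𝔼 ⧸ intLattice n) = x :=
      QuotientAddGroup.out_eq' _
    rw [eq_comm, QuotientAddGroup.eq] at h1
    obtain ⟨z, hz⟩ := h1
    have h2 : ξ + Quotient.out (x : 𝔼 ⧸ intLattice n) = ξ + x + intVec z := by rw [hz]; abel
    simp only [p]
    rw [h2, maskPoly_add_intVec]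
  have hp : ∀ κ, ∑ j ∈ Finset.range m, p (κ + j • (g : 𝔼 ⧸ intLattice n)) = 1 := by
    intro κ
    obtain ⟨x, rfl⟩ := QuotientAddGroup.mk_surjective κ
    have h1 := sum_norm_maskPoly_sq_eq_one (ν := ν) hm.pos hD (fun j hj1 hj2 => by
      have : ((j : ℝ) / m) • intVec ν ∈ maskZeros D := by
        rw [hzero]; exact ⟨j, hj1, hj2, 0, by rw [intVec_zero, add_zero]⟩
      exact this) (ξ + x)
    have h2 : ∀ j : ℕ, p ((x : 𝔼 ⧸ intLattice n) + j • (g : 𝔼 ⧸ intLattice n)) =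
        ENNReal.ofReal (‖maskPoly D (ξ + x + ((j : ℝ) / m) • intVec ν)‖ ^ 2) := by
      intro j
      rw [← QuotientAddGroup.mk_nsmul, ← QuotientAddGroup.mk_add, hpmk, ← add_assoc, hg,
        ← Nat.cast_smul_eq_nsmul ℝ, smul_smul, mul_one_div]
    simp_rw [h2]
    rw [← ENNReal.ofReal_sum_of_nonneg (fun _ _ => by positivity), h1, ENNReal.ofReal_one]
  have hcore := cosetSum_add_eq_and_tsum_selected_eq_one hm.pos hgo Λ
    (fun l => ENNReal.ofReal (‖ft σ (ξ + l)‖ ^ 2)) p hp ?_ ?_ ?_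
  · refine ⟨hcore.1, fun s hs => ?_⟩
    have h1 := hcore.2 s hs
    rw [← ENNReal.ofReal_tsum_of_nonneg (fun _ => by positivity)
      (summable_of_orthogonal (horth s) ξ)] at h1
    exact ENNReal.ofReal_eq_one.1 h1
  · intro l hl κ hκ h0
    obtain ⟨x, rfl⟩ := QuotientAddGroup.mk_surjective κ
    rw [hpmk, ENNReal.ofReal_eq_zero] at h0
    have h1 : maskPoly D (ξ + x) = 0 := by
      have : ‖maskPoly D (ξ + x)‖ ^ 2 = 0 := le_antisymm h0 (by positivity)
      simpa using this
    refine hξ l hl ?_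
    have h2 := sub_mem (hzeros _ h1) hκ
    rwa [← QuotientAddGroup.mk_sub, ← QuotientAddGroup.mk_sub,
      show ξ + x - (x - l) = ξ + l by abel] at h2
  · have h1 := hasSum_ofReal_tsum (fun _ => by positivity) (hΛ.hasSum ξ)
    rw [ENNReal.ofReal_one] at h1
    rw [← h1]
    refine tsum_congr fun l => ?_
    rw [hpmk, ← ENNReal.ofReal_mul (by positivity), hft, norm_mul, mul_pow]
  · intro s
    rw [← ENNReal.ofReal_tsum_of_nonneg (fun _ => by positivity)
      (summable_of_orthogonal (horth s) ξ)]
    exact ENNReal.ofReal_le_one.2 (tsum_le_one_of_orthogonal (horth s) ξ)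

theorem exists_mem_coset_and_isSpectrum_selected (hm : m.Prime) (hn : 0 < n) (hD : D.card = m)
    (hν : ∀ i, 1 ≤ ν i ∧ ν i ≤ (m : ℤ) - 1) (hzero : maskZeros D = latticeCosets m ν)
    {ρ σ : Measure 𝔼} [IsProbabilityMeasure ρ] [IsProbabilityMeasure σ]
    (hft : ∀ x, ft ρ x = maskPoly D x * ft σ x) {Λ : Set 𝔼} (hΛ : IsSpectrum ρ Λ) {g : 𝔼}
    (hg : g = (1 / (m : ℝ)) • intVec ν) :
    (∀ l ∈ Λ, ∀ κ : 𝔼 ⧸ intLattice n, κ - (l : 𝔼 ⧸ intLattice n) ∈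
      AddSubgroup.zmultiples (g : 𝔼 ⧸ intLattice n) → ∃ l' ∈ Λ, (l' : 𝔼 ⧸ intLattice n) = κ) ∧
    ∀ s, (∀ i, QuotientAddGroup.mk (s i) = i) →
      IsSpectrum σ (selected (intLattice n) g Λ s) := by
  have hcard : 0 < D.card := by rw [hD]; exact hm.pos
  have horth : ∀ s, ∀ a ∈ selected (intLattice n) g Λ s, ∀ b ∈ selected (intLattice n) g Λ s,
      a ≠ b → ft σ (a - b) = 0 := by
    intro s a ha b hb hab
    have h1 := orthogonal_of_hasSum hΛ.hasSum a ha.1 b hb.1 hab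
    rw [hft] at h1
    refine (mul_eq_zero.1 h1).resolve_left fun h2 => ?_
    have h3 := mk_mem_zmultiples_of_maskPoly_eq_zero hzero h2
    rw [← hg] at h3
    have h4 := selected_orthogonal ha hb h3
    rw [eq_comm, QuotientAddGroup.eq, neg_add_eq_sub] at h4
    exact maskPoly_ne_zero_of_mem hcard h4 h2
  set S : Set 𝔼 := {ξ | ∀ l ∈ Λ, ((ξ + l : 𝔼) : 𝔼 ⧸ intLattice n) ∉
      AddSubgroup.zmultiples (g : 𝔼 ⧸ intLattice n)} with hS
  have hdense : Dense S := by
    have hc : (⋃ l ∈ Λ, (fun ξ : 𝔼 => ξ + l) ⁻¹' {x : 𝔼 | (x : 𝔼 ⧸ intLattice n) ∈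
        AddSubgroup.zmultiples (g : 𝔼 ⧸ intLattice n)}).Countable :=
      hΛ.1.biUnion fun l _ => (countable_zmultiples_preimage g).preimage (add_left_injective l)
    have : Nonempty (Fin n) := Fin.pos_iff_nonempty.1 hn
    have hd := hc.dense_compl ℝ
    convert hd using 1
    ext ξ
    simp [hS]
  have hcore := fun ξ (hξ : ξ ∈ S) =>
    cosetSum_add_eq_and_tsum_selected_ft hm hn hD hν hzero hft hΛ hg horth hξ
  refine ⟨fun l hl κ hκ => ?_, fun s hs => ?_⟩
  · have hopen : IsOpen {ξ : 𝔼 | ft σ (ξ + l) ≠ 0} :=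
      isOpen_ne_fun ((continuous_ft σ).comp (continuous_add_const l)) continuous_const
    obtain ⟨ξ, hξ1, hξ2⟩ := hdense.inter_open_nonempty _ hopen
      ⟨-l, by simp [ft_zero]⟩
    by_contra! hno
    have h1 := (hcore ξ hξ2).1 κ l hκ
    rw [cosetSum_eq_zero hno, eq_comm, cosetSum, ENNReal.tsum_eq_zero] at h1
    have h2 := h1 ⟨l, hl⟩
    rw [if_pos rfl, ENNReal.ofReal_eq_zero] at h2
    refine hξ1 ?_
    have : ‖ft σ (ξ + l)‖ ^ 2 = 0 := le_antisymm h2 (by positivity)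
    simpa using this
  · exact isSpectrum_of_orthogonal_of_dense (hΛ.1.mono fun l hl => hl.1) (horth s) hdense
      fun ξ hξ => (hcore ξ hξ).2 s hs

theorem euclMap_realMat_intVec (A : Matrix (Fin n) (Fin n) ℤ) (z : Fin n → ℤ) :
    euclMap (realMat A) (intVec z) = intVec (A *ᵥ z) := by
  ext i
  simp [euclMap, intVec, realMat, Matrix.mulVec, dotProduct]

theorem euclMap_realMat_mem {A : Matrix (Fin n) (Fin n) ℤ} {x : 𝔼} (hx : x ∈ intLattice n) :
    euclMap (realMat A) x ∈ intLattice n := by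
  obtain ⟨z, rfl⟩ := hx
  exact ⟨_, (euclMap_realMat_intVec A z).symm⟩

theorem mem_intLattice_of_isSpectrum {D' : Finset (Fin n → ℤ)} {ν' : Fin n → ℤ}
    (hm : m.Prime) (hn : 0 < n) (hD : D.card = m) (hD' : D'.card = m)
    (hν : ∀ i, 1 ≤ ν i ∧ ν i ≤ (m : ℤ) - 1) (hν' : ∀ i, 1 ≤ ν' i ∧ ν' i ≤ (m : ℤ) - 1)
    (hzero : maskZeros D = latticeCosets m ν) (hzero' : maskZeros D' = latticeCosets m ν')
    {ρ σ σ' : Measure 𝔼} [IsProbabilityMeasure ρ] [IsProbabilityMeasure σ]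
    [IsProbabilityMeasure σ'] (hft : ∀ x, ft ρ x = maskPoly D x * ft σ x)
    {A : Matrix (Fin n) (Fin n) ℤ} (hA : (realMat A).det ≠ 0)
    (hft' : ∀ x, ft (σ.map (euclMap (realMat A))) x = maskPoly D' x * ft σ' x)
    {Λ : Set 𝔼} (hΛ : IsSpectrum ρ Λ) :
    euclMap (realMat Aᵀ) ((1 / (m : ℝ)) • intVec ν') ∈ intLattice n := by
  classical
  have : IsProbabilityMeasure (σ.map (euclMap (realMat A))) :=
    Measure.isProbabilityMeasure_map (by fun_prop)
  obtain ⟨g, hg⟩ : ∃ g : 𝔼, g = (1 / (m : ℝ)) • intVec ν := ⟨_, rfl⟩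
  obtain ⟨g', hg'⟩ : ∃ g : 𝔼, g = (1 / (m : ℝ)) • intVec ν' := ⟨_, rfl⟩
  rw [← hg']
  have hgo : addOrderOf (g : 𝔼 ⧸ intLattice n) = m := by
    rw [hg]; exact addOrderOf_mk_smul_intVec hm hn hν
  have hgne : (g : 𝔼 ⧸ intLattice n) ≠ 0 := by
    intro h
    rw [h, addOrderOf_zero] at hgo
    exact hm.one_lt.ne hgo
  set B := euclMap (realMat Aᵀ) with hB
  have hBA : (realMat A)ᵀ = realMat Aᵀ := rfl
  have hstep := exists_mem_coset_and_isSpectrum_selected hm hn hD hν hzero hft hΛ hg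
  -- translates by multiples of `B g'` inside a selected set
  have hmove : ∀ s, (∀ i, QuotientAddGroup.mk (s i) = i) →
      ∀ l ∈ selected (intLattice n) g Λ s, ∀ j : ℤ,
      ∃ l' ∈ selected (intLattice n) g Λ s, l' - l - j • B g' ∈ intLattice n := by
    intro s hs l hl j
    have hsp := (hstep.2 s hs).map hA
    have h1 := (exists_mem_coset_and_isSpectrum_selected hm hn hD' hν' hzero' hft' hsp hg').1
    have hAt : (realMat A)ᵀ.det ≠ 0 := by rwa [Matrix.det_transpose]
    obtain ⟨y, rfl⟩ : ∃ y, B y = l := ⟨_, euclMap_inv_apply hAt l⟩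
    obtain ⟨y', hy', heq⟩ := h1 y hl ((y + j • g' : 𝔼) : 𝔼 ⧸ intLattice n) (by
      rw [← QuotientAddGroup.mk_sub, add_sub_cancel_left, QuotientAddGroup.mk_zsmul]
      exact AddSubgroup.zsmul_mem_zmultiples _ _)
    refine ⟨B y', hy', ?_⟩
    rw [eq_comm, QuotientAddGroup.eq] at heq
    have h2 := euclMap_realMat_mem (A := Aᵀ) heq
    rw [← hB, map_add, map_neg, map_add, map_zsmul] at h2
    convert h2 using 1
    abel
  by_contra hcon
  obtain ⟨l₀, hl₀⟩ := hΛ.nonempty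
  let π : 𝔼 ⧸ intLattice n → (𝔼 ⧸ intLattice n) ⧸ AddSubgroup.zmultiples
    (g : 𝔼 ⧸ intLattice n) := QuotientAddGroup.mk
  let κ₀ : 𝔼 ⧸ intLattice n := l₀
  have hsec : ∀ κ : 𝔼 ⧸ intLattice n, π κ = π κ₀ →
      ∀ i, π (Function.update Quotient.out (π κ₀) κ i) = i := by
    intro κ hκ i
    by_cases hi : i = π κ₀
    · subst hi
      rw [Function.update_self, hκ]
    · rw [Function.update_of_ne hi]
      exact QuotientAddGroup.out_eq' _
  obtain ⟨l₁, hl₁, hd₁⟩ := hmove _ (hsec κ₀ rfl) l₀ ⟨hl₀, Function.update_self _ _ _⟩ 1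
  have hne : π (l₁ : 𝔼 ⧸ intLattice n) ≠ π κ₀ := by
    intro h
    have h1 : Function.update Quotient.out (π κ₀) κ₀ (π (l₁ : 𝔼 ⧸ intLattice n)) = l₁ := hl₁.2
    rw [h, Function.update_self] at h1
    have h2 : -l₀ + l₁ ∈ intLattice n := QuotientAddGroup.eq.1 h1
    refine hcon ?_
    have h3 := sub_mem h2 hd₁
    convert h3 using 1
    rw [one_zsmul]
    abel
  have hπ : π (κ₀ + g) = π κ₀ := by
    rw [eq_comm]
    refine QuotientAddGroup.eq.2 ?_
    rw [neg_add_cancel_left]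
    exact AddSubgroup.mem_zmultiples _
  have hl₁' : l₁ ∈ selected (intLattice n) g Λ (Function.update Quotient.out (π κ₀) (κ₀ + g)) := by
    refine ⟨hl₁.1, ?_⟩
    have h1 : Function.update Quotient.out (π κ₀) κ₀ (π (l₁ : 𝔼 ⧸ intLattice n)) = l₁ := hl₁.2
    change Function.update Quotient.out (π κ₀) (κ₀ + g) (π (l₁ : 𝔼 ⧸ intLattice n)) = l₁
    rw [Function.update_of_ne hne] at h1 ⊢
    exact h1
  obtain ⟨l₂, hl₂, hd₂⟩ := hmove _ (hsec (κ₀ + g) hπ) l₁ hl₁' (-1)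
  have h1 : (l₂ : 𝔼 ⧸ intLattice n) = κ₀ := by
    rw [eq_comm]
    refine QuotientAddGroup.eq.2 ?_
    have := add_mem hd₁ hd₂
    convert this using 1
    rw [one_zsmul, neg_one_zsmul]
    abel
  have h2 : Function.update Quotient.out (π κ₀) (κ₀ + g) (π (l₂ : 𝔼 ⧸ intLattice n)) = l₂ := hl₂.2
  rw [h1, Function.update_self, add_eq_left] at h2
  exact hgne h2

end Necessity

section Sequence

variable {n m : ℕ} {R : ℕ → Matrix (Fin n) (Fin n) ℤ} {D : ℕ → Finset (Fin n → ℤ)}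

local notation "𝔼" => EuclideanSpace ℝ (Fin n)

theorem mem_intLattice_iff_vecMul (A : Matrix (Fin n) (Fin n) ℤ) (ν : Fin n → ℤ) :
    euclMap (realMat Aᵀ) ((1 / (m : ℝ)) • intVec ν) ∈ intLattice n ↔
      ∃ z : Fin n → ℤ, (1 / (m : ℝ)) • ((fun i => (ν i : ℝ)) ᵥ* realMat A) =
        fun i => (z i : ℝ) := by
  rw [map_smul, euclMap_realMat_intVec]
  refine exists_congr fun z => ?_
  constructor
  · intro h
    funext i
    have := congrArg (fun x : 𝔼 => x i) h
    simp only [intVec_apply, PiLp.smul_apply, smul_eq_mul, Matrix.mulVec_transpose] at this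
    simp only [Pi.smul_apply, smul_eq_mul, this]
    simp [Matrix.vecMul, dotProduct, realMat]
  · intro h
    ext i
    have := congrFun h i
    simp only [intVec_apply, PiLp.smul_apply, smul_eq_mul, Matrix.mulVec_transpose, ← this,
      Pi.smul_apply]
    simp [Matrix.vecMul, dotProduct, realMat]

theorem dualMap_succ (R : ℕ → Matrix (Fin n) (Fin n) ℤ) (k : ℕ) (x : 𝔼) :
    dualMap R (k + 1) x = euclMap ((realMat (R (k + 1)))⁻¹)ᵀ (dualMap R k x) := by
  rw [dualMap, invProd, Matrix.transpose_mul, euclMap_mul_apply]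
  rfl

theorem euclMap_inv_transpose_apply {A : Matrix (Fin n) (Fin n) ℤ} (hA : (realMat A).det ≠ 0)
    (x : 𝔼) : euclMap ((realMat A)⁻¹)ᵀ (euclMap (realMat Aᵀ) x) = x := by
  have h : realMat Aᵀ = (realMat A)ᵀ := rfl
  rw [h, ← euclMap_mul_apply, ← Matrix.transpose_mul,
    Matrix.mul_nonsing_inv _ (isUnit_iff_ne_zero.2 hA), Matrix.transpose_one, euclMap_one]
  rfl

theorem IsMoranMeasure.ft_map_eq_mul (hR : ∀ k ≥ 1, (realMat (R k)).det ≠ 0)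
    (hD : ∀ k ≥ 1, (D k).Nonempty) {μ σ : Measure 𝔼} (hμ : IsMoranMeasure R D μ)
    (hσ : IsMoranMeasure (fun i => R (1 + i)) (fun i => D (1 + i)) σ) (ξ : 𝔼) :
    ft (μ.map (euclMap (realMat (R 1)))) ξ = maskPoly (D 1) ξ * ft σ ξ := by
  have h1 : dualMap R 1 (euclMap (realMat (R 1))ᵀ ξ) = ξ := by
    rw [dualMap_succ, dualMap_zero]
    exact euclMap_inv_transpose_apply (hR 1 le_rfl) ξ
  rw [ft_map, hμ.ft_eq_mul hR hD 1 hσ, ft_finiteConv hR hD, Finset.prod_range_one, zero_add, h1]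

theorem mem_intLattice_of_isSpectralMeasure (hm : m.Prime) (hn : 0 < n)
    (hD : ∀ k ≥ 1, (D k).card = m) {ν : ℕ → Fin n → ℤ}
    (hν : ∀ k ≥ 1, ∀ i, 1 ≤ ν k i ∧ ν k i ≤ (m : ℤ) - 1)
    (hzero : ∀ k ≥ 1, maskZeros (D k) = latticeCosets m (ν k))
    (hR : ∀ k ≥ 1, (realMat (R k)).det ≠ 0) {ρ : ℕ → Measure 𝔼}
    (hρ : ∀ k, IsMoranMeasure (fun i => R (k + i)) (fun i => D (k + i)) (ρ k))
    {Λ : Set 𝔼} (hΛ : IsSpectrum (ρ 0) Λ) (k : ℕ) :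
    euclMap (realMat (R (k + 2))ᵀ) ((1 / (m : ℝ)) • intVec (ν (k + 2))) ∈ intLattice n := by
  have hne : ∀ k ≥ 1, (D k).Nonempty := fun k hk => by
    rw [← Finset.card_pos, hD k hk]; exact hm.pos
  have hprob : ∀ k, IsProbabilityMeasure (ρ k) := fun k => (hρ k).1
  have hprob' : ∀ k, IsProbabilityMeasure ((ρ k).map (euclMap (realMat (R (k + 1))))) :=
    fun k => Measure.isProbabilityMeasure_map (by fun_prop)
  have hft : ∀ k x, ft ((ρ k).map (euclMap (realMat (R (k + 1))))) x =
      maskPoly (D (k + 1)) x * ft (ρ (k + 1)) x := by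
    intro k x
    refine (hρ k).ft_map_eq_mul (fun j hj => hR _ (by omega)) (fun j hj => hne _ (by omega)) ?_ x
    simpa only [← add_assoc] using hρ (k + 1)
  have hspec : ∀ k, ∃ Λ, IsSpectrum (ρ k) Λ := by
    intro k
    induction k with
    | zero => exact ⟨Λ, hΛ⟩
    | succ k ih =>
      obtain ⟨Λ, hΛ⟩ := ih
      exact ⟨_, (exists_mem_coset_and_isSpectrum_selected hm hn (hD (k + 1) (by omega))
        (hν (k + 1) (by omega)) (hzero (k + 1) (by omega)) (hft k)
        (hΛ.map (hR (k + 1) (by omega))) rfl).2 Quotient.out fun i => QuotientAddGroup.out_eq' i⟩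
  obtain ⟨Λ, hΛ⟩ := hspec k
  exact mem_intLattice_of_isSpectrum hm hn (hD (k + 1) (by omega)) (hD (k + 2) (by omega))
    (hν (k + 1) (by omega)) (hν (k + 2) (by omega)) (hzero (k + 1) (by omega))
    (hzero (k + 2) (by omega)) (hft k) (hR (k + 2) (by omega)) (hft (k + 1))
    (hΛ.map (hR (k + 1) (by omega)))

end Sequence

section LowerBound

variable {n m : ℕ} {R : ℕ → Matrix (Fin n) (Fin n) ℤ} {D : ℕ → Finset (Fin n → ℤ)}

local notation "𝔼" => EuclideanSpace ℝ (Fin n)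

theorem exists_add_intVec_mem_cube (x : 𝔼) {δ : ℝ} (hδ : 0 ≤ δ) :
    ∃ z : Fin n → ℤ, x + intVec z ∈ cube n δ := by
  refine ⟨fun i => -round (x i), fun i => ?_⟩
  have h := abs_le.1 (abs_sub_round (x i))
  simp only [PiLp.add_apply, intVec_apply, Int.cast_neg, Set.mem_Icc]
  constructor <;> linarith [h.1, h.2]

theorem norm_le_of_mem_cube {δ : ℝ} (hδ : δ ≤ 1 / 2) {x : 𝔼} (hx : x ∈ cube n δ) :
    ‖x‖ ≤ √n := by
  rw [EuclideanSpace.norm_eq]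
  refine Real.sqrt_le_sqrt ?_
  have h1 : ∀ i ∈ Finset.univ, ‖x i‖ ^ 2 ≤ 1 := by
    intro i _
    have h := hx i
    rw [Set.mem_Icc] at h
    have h2 : ‖x i‖ ≤ 1 := by
      rw [Real.norm_eq_abs, abs_le]
      constructor <;> linarith [h.1, h.2]
    exact pow_le_one₀ (norm_nonneg _) h2
  have := Finset.sum_le_card_nsmul Finset.univ _ 1 h1
  simpa using this

theorem exists_lower_bound_maskPoly (D : Finset (Fin n → ℤ)) {β : ℝ} (hβ : 0 < β) :
    ∃ c > 0, ∀ x ∉ Metric.thickening β (maskZeros D), c ≤ ‖maskPoly D x‖ := by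
  set K : Set 𝔼 := Metric.closedBall 0 (√n) ∩ (Metric.thickening β (maskZeros D))ᶜ with hK
  have hKc : IsCompact K := (isCompact_closedBall _ _).inter_right
    Metric.isOpen_thickening.isClosed_compl
  have hred : ∀ x ∉ Metric.thickening β (maskZeros D),
      ∃ y ∈ K, ‖maskPoly D y‖ = ‖maskPoly D x‖ := by
    intro x hx
    obtain ⟨z, hz⟩ := exists_add_intVec_mem_cube x le_rfl
    refine ⟨x + intVec z, ⟨?_, ?_⟩, by rw [maskPoly_add_intVec]⟩
    · rw [mem_closedBall_zero_iff]
      exact norm_le_of_mem_cube (by norm_num) hz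
    · intro h
      rw [Metric.mem_thickening_iff] at h
      obtain ⟨w, hw, hd⟩ := h
      refine hx (Metric.mem_thickening_iff.2 ⟨w + intVec (-z), ?_, ?_⟩)
      · change maskPoly D _ = 0
        rw [maskPoly_add_intVec]
        exact hw
      · rw [dist_eq_norm] at hd ⊢
        convert hd using 2
        have : intVec (-z) = -intVec z := by ext i; simp [intVec_apply]
        rw [this]
        abel
  rcases K.eq_empty_or_nonempty with hemp | hne
  · refine ⟨1, one_pos, fun x hx => ?_⟩
    obtain ⟨y, hy, -⟩ := hred x hx
    rw [hemp] at hy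
    exact absurd hy (Set.notMem_empty _)
  · obtain ⟨y₀, hy₀, hmin⟩ := hKc.exists_isMinOn hne (continuous_maskPoly D).norm.continuousOn
    refine ⟨‖maskPoly D y₀‖, ?_, fun x hx => ?_⟩
    · rw [gt_iff_lt, norm_pos_iff]
      intro h0
      exact hy₀.2 (Metric.self_subset_thickening hβ _ h0)
    · obtain ⟨y, hy, heq⟩ := hred x hx
      rw [← heq]
      exact hmin hy

theorem finite_digitSets {C : ℝ} (hC : ∀ k ≥ 1, ∀ d ∈ D k, ‖intVec d‖ ≤ C) :
    (D '' Set.Ici 1).Finite := by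
  refine ((Finset.Icc (fun _ : Fin n => -⌈C⌉) (fun _ => ⌈C⌉)).powerset.finite_toSet).subset ?_
  rintro _ ⟨k, hk, rfl⟩
  rw [Finset.mem_coe, Finset.mem_powerset]
  intro d hd
  have h1 : ∀ i, |d i| ≤ ⌈C⌉ := by
    intro i
    have h2 : |(d i : ℝ)| ≤ ‖intVec d‖ := PiLp.norm_apply_le (intVec d) i
    have h3 : ((|d i| : ℤ) : ℝ) ≤ (⌈C⌉ : ℝ) := by
      push_cast
      exact (h2.trans (hC k hk d hd)).trans (Int.le_ceil C)
    exact_mod_cast h3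
  rw [Finset.mem_Icc]
  exact ⟨fun i => (abs_le.1 (h1 i)).1, fun i => (abs_le.1 (h1 i)).2⟩

theorem exists_uniform_lower_bound_maskPoly {C β : ℝ} (hβ : 0 < β)
    (hC : ∀ k ≥ 1, ∀ d ∈ D k, ‖intVec d‖ ≤ C) :
    ∃ c > 0, ∀ k ≥ 1, ∀ x ∉ Metric.thickening β (⋃ k ∈ Set.Ici 1, maskZeros (D k)),
      c ≤ ‖maskPoly (D k) x‖ := by
  choose c hc hcx using fun D₀ : Finset (Fin n → ℤ) => exists_lower_bound_maskPoly D₀ hβ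
  have hfin := finite_digitSets hC
  obtain ⟨D₀, -, hmin⟩ := Set.exists_min_image _ c hfin ⟨_, ⟨1, Set.mem_Ici.2 le_rfl, rfl⟩⟩
  refine ⟨c D₀, hc D₀, fun k hk x hx => (hmin _ ⟨k, hk, rfl⟩).trans (hcx _ x fun h => hx ?_)⟩
  exact Metric.thickening_subset_of_subset β (Set.subset_biUnion_of_mem (u := fun k =>
    maskZeros (D k)) hk) h

theorem realMat_mul (A B : Matrix (Fin n) (Fin n) ℤ) : realMat (A * B) = realMat A * realMat B :=
  Matrix.map_mul (f := Int.castRingHom ℝ)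

theorem transposeProd_dualMap (hR : ∀ k ≥ 1, (realMat (R k)).det ≠ 0) (k p : ℕ) (x : 𝔼) :
    euclMap (realMat (transposeProd R k p)) (dualMap (fun i => R (k + i)) p x) = x := by
  induction p with
  | zero => simp [transposeProd, realMat, dualMap_zero, euclMap_one]
  | succ p ih =>
    have h : (realMat (R (k + p + 1))ᵀ).det ≠ 0 := by
      change (realMat (R (k + p + 1)))ᵀ.det ≠ 0
      rw [Matrix.det_transpose]
      exact hR _ (by omega)
    rw [transposeProd, realMat_mul, euclMap_mul_apply, dualMap_succ, Matrix.transpose_nonsing_inv]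
    have h2 := euclMap_inv_apply h (dualMap (fun i => R (k + i)) p x)
    rw [← add_assoc]
    exact (congrArg _ h2).trans ih

theorem dualMap_transposeProd (hR : ∀ k ≥ 1, (realMat (R k)).det ≠ 0) (k p : ℕ) (x : 𝔼) :
    dualMap (fun i => R (k + i)) p (euclMap (realMat (transposeProd R k p)) x) = x := by
  induction p generalizing x with
  | zero => simp [transposeProd, realMat, dualMap_zero, euclMap_one]
  | succ p ih =>
    rw [transposeProd, realMat_mul, euclMap_mul_apply, dualMap_succ, ih, ← add_assoc]
    exact euclMap_inv_transpose_apply (hR _ (by omega)) x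

theorem exists_lower_bound_ft {C r : ℝ} (hr0 : 0 < r) (hr1 : r < 1) {K : ℕ}
    (hK : ∀ k ≥ K, GeomDecay (fun i => R (k + i)) 1 r)
    (hC : ∀ k ≥ 1, ∀ d ∈ D k, ‖intVec d‖ ≤ C) (hD : ∀ k ≥ 1, (D k).Nonempty)
    (hR : ∀ k ≥ 1, (realMat (R k)).det ≠ 0) {δ β : ℝ} (hδ : δ ≤ 1 / 2) (hβ : 0 < β) {N : ℕ}
    (hadm : ∀ k > N, ∀ p ≥ 1, transposeProd R k p ∈ admissible D δ β) {ρ : ℕ → Measure 𝔼}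
    (hρ : ∀ k, IsMoranMeasure (fun i => R (k + i)) (fun i => D (k + i)) (ρ k)) :
    ∃ ε > 0, ∃ N', ∀ k ≥ N', ∀ y ∈ cube n δ, ε ≤ ‖ft (ρ k) y‖ := by
  obtain ⟨c, hc0, hc⟩ := exists_uniform_lower_bound_maskPoly hβ hC
  have hC0 : 0 ≤ C := by
    obtain ⟨d, hd⟩ := hD 1 le_rfl
    exact (norm_nonneg _).trans (hC 1 le_rfl d hd)
  have hprob : ∀ k, IsProbabilityMeasure (ρ k) := fun k => (hρ k).1
  obtain ⟨P, hP⟩ : ∃ P : ℕ, 2 * Real.pi * (1 * C * (1 - r)⁻¹ * (r ^ P * √n)) ≤ 1 / 2 := by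
    have h1 : Tendsto (fun P : ℕ => 2 * Real.pi * (1 * C * (1 - r)⁻¹ * (r ^ P * √n))) atTop
        (𝓝 (2 * Real.pi * (1 * C * (1 - r)⁻¹ * (0 * √n)))) :=
      (((tendsto_pow_atTop_nhds_zero_of_lt_one hr0.le hr1).mul_const _).const_mul _).const_mul _
    rw [zero_mul, mul_zero, mul_zero] at h1
    exact (h1.eventually_le_const (by norm_num : (0 : ℝ) < 1 / 2)).exists
  refine ⟨c ^ P * (1 / 2), by positivity, max K (N + 1), fun k hk y hy => ?_⟩
  have hkK : K ≤ k := (le_max_left _ _).trans hk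
  have hkN : N < k := (le_max_right K (N + 1)).trans hk
  have hshift : IsMoranMeasure (fun i => R (k + (P + i))) (fun i => D (k + (P + i)))
      (ρ (k + P)) := by simpa only [add_assoc] using hρ (k + P)
  rw [(hρ k).ft_eq_mul (fun j hj => hR _ (by omega)) (fun j hj => hD _ (by omega)) P hshift y,
    norm_mul, ft_finiteConv (fun j hj => hR _ (by omega)) (fun j hj => hD _ (by omega)), norm_prod]
  refine mul_le_mul ?_ ?_ (by norm_num) (Finset.prod_nonneg fun _ _ => norm_nonneg _)
  · have h1 : ∀ j ∈ Finset.range P, c ≤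
        ‖maskPoly (D (k + (j + 1))) (dualMap (fun i => R (k + i)) (j + 1) y)‖ := by
      intro j _
      refine hc _ (by omega) _ fun hmem => ?_
      have h2 : (dualMap (fun i => R (k + i)) (j + 1) y) ∈
          (euclMap (realMat (transposeProd R k (j + 1))) ⁻¹' cube n δ) ∩
            Metric.thickening β (⋃ k ∈ Set.Ici 1, maskZeros (D k)) := by
        refine ⟨?_, hmem⟩
        rw [Set.mem_preimage, transposeProd_dualMap hR]
        exact hy
      have h3 : _ = ∅ := hadm k hkN (j + 1) (by omega)
      rw [h3] at h2
      exact h2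
    have h4 := Finset.prod_le_prod (s := Finset.range P) (fun _ _ => hc0.le) h1
    rwa [Finset.prod_const, Finset.card_range] at h4
  · have hsupp := (hρ (k + P)).ae_norm_le hr0 hr1 (hK (k + P) (by omega))
      (fun j hj => hC _ (by omega)) (fun j hj => hD _ (by omega))
    have h1 := norm_ft_sub_one_le hsupp (dualMap (fun i => R (k + i)) P y)
    have h2 : ‖dualMap (fun i => R (k + i)) P y‖ ≤ r ^ P * √n := by
      refine (ContinuousLinearMap.le_opNorm _ _).trans ?_
      have h3 := hK k hkK P
      rw [one_mul, ← norm_dualMap] at h3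
      exact mul_le_mul h3 (norm_le_of_mem_cube hδ hy) (norm_nonneg _) (by positivity)
    have h4 : ‖ft (ρ (k + P)) (dualMap (fun i => R (k + i)) P y) - 1‖ ≤ 1 / 2 := by
      refine h1.trans (le_trans ?_ hP)
      have : 0 ≤ (1 - r)⁻¹ := inv_nonneg.2 (by linarith)
      gcongr
    have h5 := norm_sub_norm_le (1 : ℂ) (1 - ft (ρ (k + P)) (dualMap (fun i => R (k + i)) P y))
    rw [sub_sub_cancel, norm_one, norm_sub_rev (1 : ℂ)] at h5
    linarith

end LowerBound

section Sufficiency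

variable {n m : ℕ} {R : ℕ → Matrix (Fin n) (Fin n) ℤ} {D : ℕ → Finset (Fin n → ℤ)}
  {ν : ℕ → Fin n → ℤ}

local notation "𝔼" => EuclideanSpace ℝ (Fin n)

/-- `Λ` is a spectrum of the `l`-th finite convolution. -/
def IsLevelSpectrum (R : ℕ → Matrix (Fin n) (Fin n) ℤ) (D : ℕ → Finset (Fin n → ℤ)) (l : ℕ)
    (Λ : Finset (EuclideanSpace ℝ (Fin n))) : Prop :=
  ∀ ξ, ∑ x ∈ Λ, ‖ft (finiteConv R D l) (ξ + x)‖ ^ 2 = 1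

/-- The map `x ↦ R₁ᵗ ⋯ R_lᵗ x`. -/
def latticeMap (R : ℕ → Matrix (Fin n) (Fin n) ℤ) (l : ℕ) :
    EuclideanSpace ℝ (Fin n) →L[ℝ] EuclideanSpace ℝ (Fin n) :=
  euclMap (realMat (transposeProd R 0 l))

theorem dualMap_latticeMap (hR : ∀ k ≥ 1, (realMat (R k)).det ≠ 0) (l : ℕ) (x : 𝔼) :
    dualMap R l (latticeMap R l x) = x := by
  have h := dualMap_transposeProd hR 0 l x
  simp only [zero_add] at h
  exact h

theorem latticeMap_succ (R : ℕ → Matrix (Fin n) (Fin n) ℤ) (l : ℕ) (x : 𝔼) :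
    latticeMap R (l + 1) x = latticeMap R l (euclMap (realMat (R (l + 1))ᵀ) x) := by
  rw [latticeMap, transposeProd, realMat_mul, euclMap_mul_apply, zero_add]
  rfl

theorem ft_finiteConv_succ (hR : ∀ k ≥ 1, (realMat (R k)).det ≠ 0) (hD : ∀ k ≥ 1, (D k).Nonempty)
    (l : ℕ) (ξ : 𝔼) : ft (finiteConv R D (l + 1)) ξ =
      ft (finiteConv R D l) ξ * maskPoly (D (l + 1)) (dualMap R (l + 1) ξ) := by
  rw [ft_finiteConv hR hD, ft_finiteConv hR hD, Finset.prod_range_succ]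

theorem ft_finiteConv_add_latticeMap (hR : ∀ k ≥ 1, (realMat (R k)).det ≠ 0)
    (hD : ∀ k ≥ 1, (D k).Nonempty) (l : ℕ) (ξ : 𝔼) {z : 𝔼} (hz : z ∈ intLattice n) :
    ft (finiteConv R D l) (ξ + latticeMap R l z) = ft (finiteConv R D l) ξ := by
  induction l generalizing z with
  | zero => simp [ft_finiteConv hR hD]
  | succ l ih =>
    rw [ft_finiteConv_succ hR hD, ft_finiteConv_succ hR hD, map_add, dualMap_latticeMap hR,
      latticeMap_succ, ih (euclMap_realMat_mem hz)]
    obtain ⟨z, rfl⟩ := hz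
    rw [maskPoly_add_intVec]

theorem injOn_of_sum_norm_sq_eq_one {ι V : Type*} [AddCommGroup V] {F : V → ℂ} (h0 : F 0 = 1)
    {s : Finset ι} {g : ι → V} (h : ∀ ξ, ∑ i ∈ s, ‖F (ξ + g i)‖ ^ 2 = 1) : Set.InjOn g s := by
  classical
  intro i hi j hj hij
  by_contra hne
  have h1 : ∑ k ∈ {i, j}, ‖F (-g i + g k)‖ ^ 2 ≤ ∑ k ∈ s, ‖F (-g i + g k)‖ ^ 2 :=
    Finset.sum_le_sum_of_subset_of_nonneg (by
      intro k hk
      rcases Finset.mem_insert.1 hk with rfl | hk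
      · exact hi
      · rw [Finset.mem_singleton.1 hk]; exact hj) fun _ _ _ => by positivity
  rw [h, Finset.sum_pair hne, ← hij, neg_add_cancel, h0, norm_one] at h1
  norm_num at h1

open Classical in
theorem isLevelSpectrum_image {ι : Type*} (hD : ∀ k ≥ 1, (D k).Nonempty) {l : ℕ}
    {s : Finset ι} {g : ι → 𝔼}
    (h : ∀ ξ, ∑ i ∈ s, ‖ft (finiteConv R D l) (ξ + g i)‖ ^ 2 = 1) :
    IsLevelSpectrum R D l (s.image g) := by
  have := isProbabilityMeasure_finiteConv (R := R) hD l
  intro ξ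
  rw [Finset.sum_image (injOn_of_sum_norm_sq_eq_one (ft_zero _) h), h]

theorem IsLevelSpectrum.exists_succ (hm : 0 < m) (hDm : ∀ k ≥ 1, (D k).card = m)
    (hzero : ∀ k ≥ 1, maskZeros (D k) = latticeCosets m (ν k))
    (hR : ∀ k ≥ 1, (realMat (R k)).det ≠ 0)
    (hint : ∀ k ≥ 2, euclMap (realMat (R k)ᵀ) ((1 / (m : ℝ)) • intVec (ν k)) ∈ intLattice n)
    {l : ℕ} {Λ : Finset 𝔼} (hΛ : IsLevelSpectrum R D l Λ) :
    ∃ Λ', Λ ⊆ Λ' ∧ IsLevelSpectrum R D (l + 1) Λ' := by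
  classical
  have hD : ∀ k ≥ 1, (D k).Nonempty := fun k hk => by
    rw [← Finset.card_pos, hDm k hk]; exact hm
  have hper : ∀ (j : ℕ) (ξ : 𝔼), ft (finiteConv R D l)
      (ξ + latticeMap R (l + 1) (((j : ℝ) / m) • intVec (ν (l + 1)))) =
        ft (finiteConv R D l) ξ := by
    intro j ξ
    rcases Nat.eq_zero_or_pos l with rfl | hl
    · simp [ft_finiteConv hR hD]
    · rw [latticeMap_succ, ft_finiteConv_add_latticeMap hR hD]
      have h1 : ((j : ℝ) / m) • intVec (ν (l + 1)) =
          j • ((1 / (m : ℝ)) • intVec (ν (l + 1)) : 𝔼) := by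
        rw [← Nat.cast_smul_eq_nsmul ℝ, smul_smul, mul_one_div]
      rw [h1, map_nsmul]
      exact nsmul_mem (hint (l + 1) (by omega)) j
  refine ⟨(Λ ×ˢ Finset.range m).image fun p =>
    p.1 + latticeMap R (l + 1) (((p.2 : ℝ) / m) • intVec (ν (l + 1))), ?_, ?_⟩
  · intro x hx
    exact Finset.mem_image.2 ⟨(x, 0), by simp [hx, hm], by simp⟩
  · refine isLevelSpectrum_image hD fun ξ => ?_
    rw [Finset.sum_product, ← hΛ ξ]
    refine Finset.sum_congr rfl fun x _ => ?_
    have h1 := sum_norm_maskPoly_sq_eq_one (ν := ν (l + 1)) hm (hDm (l + 1) (by omega))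
      (fun j hj1 hj2 => by
        have : ((j : ℝ) / m) • intVec (ν (l + 1)) ∈ maskZeros (D (l + 1)) := by
          rw [hzero _ (by omega)]; exact ⟨j, hj1, hj2, 0, by rw [intVec_zero, add_zero]⟩
        exact this) (dualMap R (l + 1) (ξ + x))
    rw [← mul_one (‖_‖ ^ 2), ← h1, Finset.mul_sum]
    refine Finset.sum_congr rfl fun j _ => ?_
    rw [ft_finiteConv_succ hR hD, ← add_assoc, hper, map_add _ (ξ + x), dualMap_latticeMap hR,
      norm_mul, mul_pow]

theorem IsLevelSpectrum.exists_cube (hD : ∀ k ≥ 1, (D k).Nonempty)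
    (hR : ∀ k ≥ 1, (realMat (R k)).det ≠ 0) {δ : ℝ} (hδ : 0 ≤ δ) {l : ℕ} {Λ Λ' : Finset 𝔼}
    (hΛ' : IsLevelSpectrum R D l Λ') (hsub : Λ ⊆ Λ') (hcube : ∀ x ∈ Λ, dualMap R l x ∈ cube n δ) :
    ∃ Λ'', Λ ⊆ Λ'' ∧ IsLevelSpectrum R D l Λ'' ∧ ∀ x ∈ Λ'', dualMap R l x ∈ cube n δ := by
  classical
  choose z hz using fun x : 𝔼 => exists_add_intVec_mem_cube (dualMap R l x) hδ
  refine ⟨Λ'.image fun x => if x ∈ Λ then x else x + latticeMap R l (intVec (z x)), ?_, ?_, ?_⟩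
  · intro x hx
    exact Finset.mem_image.2 ⟨x, hsub hx, if_pos hx⟩
  · refine isLevelSpectrum_image hD fun ξ => ?_
    rw [← hΛ' ξ]
    refine Finset.sum_congr rfl fun x _ => ?_
    split_ifs with hx
    · rfl
    · rw [← add_assoc, ft_finiteConv_add_latticeMap hR hD _ _ ⟨z x, rfl⟩]
  · intro y hy
    obtain ⟨x, -, rfl⟩ := Finset.mem_image.1 hy
    split_ifs with hx
    · exact hcube x hx
    · rw [map_add, dualMap_latticeMap hR]
      exact hz x

theorem GeomDecay.tendsto_dualMap {B r : ℝ} (hr0 : 0 < r) (hr1 : r < 1) (hgeo : GeomDecay R B r)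
    (x : 𝔼) : Tendsto (fun l => ‖dualMap R l x‖) atTop (𝓝 0) := by
  have h1 : Tendsto (fun l : ℕ => B * r ^ l * ‖x‖) atTop (𝓝 (B * 0 * ‖x‖)) :=
    ((tendsto_pow_atTop_nhds_zero_of_lt_one hr0.le hr1).const_mul _).mul_const _
  rw [mul_zero, zero_mul] at h1
  refine squeeze_zero (fun _ => norm_nonneg _) (fun l => ?_) h1
  refine (ContinuousLinearMap.le_opNorm _ _).trans ?_
  gcongr
  rw [norm_dualMap]
  exact hgeo l

theorem mem_cube_of_norm_le {δ : ℝ} {x : 𝔼} (hx : ‖x‖ ≤ 1 / 2 + δ) : x ∈ cube n δ := by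
  intro i
  have h := (PiLp.norm_apply_le x i).trans hx
  rw [Real.norm_eq_abs, abs_le] at h
  exact ⟨by linarith [h.1], h.2⟩

theorem add_mem_cube {δ ε : ℝ} {x y : 𝔼} (hx : x ∈ cube n δ) (hy : ‖y‖ ≤ ε) :
    y + x ∈ cube n (δ + ε) := by
  intro i
  have h := (PiLp.norm_apply_le y i).trans hy
  rw [Real.norm_eq_abs, abs_le] at h
  have h2 := hx i
  rw [Set.mem_Icc] at h2 ⊢
  rw [PiLp.add_apply]
  constructor <;> linarith [h.1, h.2, h2.1, h2.2]

theorem IsLevelSpectrum.exists_extension (hm : 0 < m) (hDm : ∀ k ≥ 1, (D k).card = m)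
    (hzero : ∀ k ≥ 1, maskZeros (D k) = latticeCosets m (ν k))
    (hR : ∀ k ≥ 1, (realMat (R k)).det ≠ 0)
    (hint : ∀ k ≥ 2, euclMap (realMat (R k)ᵀ) ((1 / (m : ℝ)) • intVec (ν k)) ∈ intLattice n)
    {B r : ℝ} (hr0 : 0 < r) (hr1 : r < 1) (hgeo : GeomDecay R B r) {δ : ℝ} (hδ : 0 ≤ δ)
    {l : ℕ} {Λ : Finset 𝔼} (hΛ : IsLevelSpectrum R D l Λ) :
    ∃ l' > l, ∃ Λ', Λ ⊆ Λ' ∧ IsLevelSpectrum R D l' Λ' ∧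
      ∀ x ∈ Λ', dualMap R l' x ∈ cube n δ := by
  have hD : ∀ k ≥ 1, (D k).Nonempty := fun k hk => by
    rw [← Finset.card_pos, hDm k hk]; exact hm
  have hev : ∀ᶠ l' in atTop, ∀ x ∈ Λ, ‖dualMap R l' x‖ ≤ 1 / 2 + δ := by
    rw [Filter.eventually_all_finset]
    intro x _
    exact (hgeo.tendsto_dualMap hr0 hr1 x).eventually_le_const (by linarith)
  obtain ⟨l', hl', hcube⟩ := ((eventually_gt_atTop l).and hev).exists
  have hext : ∀ p, ∃ Λ', Λ ⊆ Λ' ∧ IsLevelSpectrum R D (l + p) Λ' := by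
    intro p
    induction p with
    | zero => exact ⟨Λ, subset_rfl, hΛ⟩
    | succ p ih =>
      obtain ⟨Λ₁, h1, h2⟩ := ih
      obtain ⟨Λ₂, h3, h4⟩ := h2.exists_succ hm hDm hzero hR hint
      exact ⟨Λ₂, h1.trans h3, h4⟩
  obtain ⟨Λ₁, h1, h2⟩ := hext (l' - l)
  rw [Nat.add_sub_cancel' hl'.le] at h2
  obtain ⟨Λ₂, h3⟩ := h2.exists_cube hD hR hδ h1 fun x hx => mem_cube_of_norm_le (hcube x hx)
  exact ⟨l', hl', Λ₂, h3⟩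

theorem exists_levelSpectrum_seq (hm : 0 < m) (hDm : ∀ k ≥ 1, (D k).card = m)
    (hzero : ∀ k ≥ 1, maskZeros (D k) = latticeCosets m (ν k))
    (hR : ∀ k ≥ 1, (realMat (R k)).det ≠ 0)
    (hint : ∀ k ≥ 2, euclMap (realMat (R k)ᵀ) ((1 / (m : ℝ)) • intVec (ν k)) ∈ intLattice n)
    {B r : ℝ} (hr0 : 0 < r) (hr1 : r < 1) (hgeo : GeomDecay R B r) {δ : ℝ} (hδ : 0 ≤ δ) :
    ∃ (L : ℕ → ℕ) (Λ : ℕ → Finset 𝔼), StrictMono L ∧ Monotone Λ ∧ ∀ i,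
      IsLevelSpectrum R D (L i) (Λ i) ∧ ∀ x ∈ Λ i, dualMap R (L i) x ∈ cube n δ := by
  have hD : ∀ k ≥ 1, (D k).Nonempty := fun k hk => by
    rw [← Finset.card_pos, hDm k hk]; exact hm
  let T := {p : ℕ × Finset 𝔼 // IsLevelSpectrum R D p.1 p.2 ∧
    ∀ x ∈ p.2, dualMap R p.1 x ∈ cube n δ}
  have hstep : ∀ p : T, ∃ q : T, p.1.1 < q.1.1 ∧ p.1.2 ⊆ q.1.2 := by
    rintro ⟨⟨l, Λ⟩, h, -⟩
    obtain ⟨l', hl', Λ', hsub, h1, h2⟩ :=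
      h.exists_extension hm hDm hzero hR hint hr0 hr1 hgeo hδ
    exact ⟨⟨(l', Λ'), h1, h2⟩, hl', hsub⟩
  choose next hnext using hstep
  let start : T := ⟨(0, {0}), fun ξ => by simp [ft_finiteConv hR hD], fun x hx =>
    mem_cube_of_norm_le (by
      rw [Finset.mem_singleton.1 hx, map_zero, norm_zero]
      linarith)⟩
  let f : ℕ → T := fun i => Nat.rec start (fun _ p => next p) i
  exact ⟨fun i => (f i).1.1, fun i => (f i).1.2, strictMono_nat_of_lt_succ fun i => (hnext (f i)).1,
    monotone_nat_of_le_succ fun i => (hnext (f i)).2, fun i => (f i).2⟩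

theorem exists_isSpectrum (hm : 0 < m) (hDm : ∀ k ≥ 1, (D k).card = m)
    (hzero : ∀ k ≥ 1, maskZeros (D k) = latticeCosets m (ν k))
    (hR : ∀ k ≥ 1, (realMat (R k)).det ≠ 0)
    (hint : ∀ k ≥ 2, euclMap (realMat (R k)ᵀ) ((1 / (m : ℝ)) • intVec (ν k)) ∈ intLattice n)
    {B r : ℝ} (hr0 : 0 < r) (hr1 : r < 1) (hgeo : GeomDecay R B r) {δ : ℝ} (hδ : 0 < δ)
    {μ : Measure 𝔼} (hμ : IsMoranMeasure R D μ) {ρ : ℕ → Measure 𝔼}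
    (hρ : ∀ k, IsMoranMeasure (fun i => R (k + i)) (fun i => D (k + i)) (ρ k))
    {ε : ℝ} (hε : 0 < ε) {N : ℕ} (hlow : ∀ k ≥ N, ∀ y ∈ cube n δ, ε ≤ ‖ft (ρ k) y‖) :
    ∃ Λ, IsSpectrum μ Λ := by
  classical
  have hD : ∀ k ≥ 1, (D k).Nonempty := fun k hk => by
    rw [← Finset.card_pos, hDm k hk]; exact hm
  have hprob := hμ.1
  have hprobρ : ∀ k, IsProbabilityMeasure (ρ k) := fun k => (hρ k).1
  obtain ⟨L, Λs, hL, hmono, hΛs⟩ :=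
    exists_levelSpectrum_seq hm hDm hzero hR hint hr0 hr1 hgeo (half_pos hδ).le
  have hfac : ∀ l ξ, ‖ft μ ξ‖ ^ 2 =
      ‖ft (finiteConv R D l) ξ‖ ^ 2 * ‖ft (ρ l) (dualMap R l ξ)‖ ^ 2 := fun l ξ => by
    rw [hμ.ft_eq_mul hR hD l (hρ l), norm_mul, mul_pow]
  have hle : ∀ l ξ, ‖ft μ ξ‖ ^ 2 ≤ ‖ft (finiteConv R D l) ξ‖ ^ 2 := fun l ξ => by
    rw [hfac l ξ]
    exact mul_le_of_le_one_right (by positivity)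
      (pow_le_one₀ (norm_nonneg _) (norm_ft_le_one _ _))
  refine ⟨⋃ i, (Λs i : Set 𝔼), isSpectrum_of_hasSum
    (Set.countable_iUnion fun i => (Λs i).countable_toSet) fun ξ => ?_⟩
  set Λ : Set 𝔼 := ⋃ i, (Λs i : Set 𝔼)
  have hex : ∀ x : Λ, ∃ i, (x : 𝔼) ∈ Λs i := fun x =>
    Set.mem_iUnion.1 x.2
  have hevmem : ∀ x : Λ, ∀ᶠ i in atTop, (x : 𝔼) ∈ Λs i := fun x => by
    obtain ⟨i, hi⟩ := hex x
    exact (eventually_ge_atTop i).mono fun j hj => hmono hj hi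
  have hsum : ∀ i (F : 𝔼 → ℝ), ∑' x : Λ, (if (x : 𝔼) ∈ Λs i then F x else 0) =
      ∑ x ∈ Λs i, F x := by
    intro i F
    rw [tsum_subtype Λ fun x => if x ∈ Λs i then F x else 0,
      tsum_eq_sum (s := Λs i) fun x hx => by simp [Set.indicator_apply, hx]]
    refine Finset.sum_congr rfl fun x hx => ?_
    rw [Set.indicator_of_mem (Set.mem_iUnion.2 ⟨i, hx⟩), if_pos hx]
  have hsummable : Summable fun x : Λ => ‖ft μ (ξ + x)‖ ^ 2 := by
    refine summable_of_sum_le (c := 1) (fun _ => by positivity) fun s => ?_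
    have hev : ∀ᶠ i in atTop, ∀ x ∈ s, (x : 𝔼) ∈ Λs i := by
      rw [Filter.eventually_all_finset]
      exact fun x _ => hevmem x
    obtain ⟨i, hi⟩ := hev.exists
    rw [← (hΛs i).1 ξ]
    calc ∑ x ∈ s, ‖ft μ (ξ + x)‖ ^ 2
        = ∑ x ∈ s.image ((↑) : Λ → 𝔼), ‖ft μ (ξ + x)‖ ^ 2 := by
          rw [Finset.sum_image Subtype.val_injective.injOn]
      _ ≤ ∑ x ∈ Λs i, ‖ft μ (ξ + x)‖ ^ 2 := by
          refine Finset.sum_le_sum_of_subset_of_nonneg ?_ fun _ _ _ => by positivity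
          intro x hx
          obtain ⟨y, hy, rfl⟩ := Finset.mem_image.1 hx
          exact hi y hy
      _ ≤ _ := Finset.sum_le_sum fun x _ => hle _ _
  have hlim := tendsto_tsum_of_dominated_convergence (𝓕 := atTop)
    (f := fun i (x : Λ) =>
      if (x : 𝔼) ∈ Λs i then ‖ft (finiteConv R D (L i)) (ξ + x)‖ ^ 2 else 0)
    (g := fun x : Λ => ‖ft μ (ξ + x)‖ ^ 2)
    (bound := fun x : Λ => (ε ^ 2)⁻¹ * ‖ft μ (ξ + x)‖ ^ 2) (hsummable.mul_left _) ?_ ?_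
  · have h1 : ∀ i, ∑' x : Λ, (if (x : 𝔼) ∈ Λs i then
        ‖ft (finiteConv R D (L i)) (ξ + x)‖ ^ 2 else 0) = 1 := fun i => by
      rw [hsum i fun x => ‖ft (finiteConv R D (L i)) (ξ + x)‖ ^ 2, (hΛs i).1]
    simp_rw [h1] at hlim
    rw [tendsto_nhds_unique tendsto_const_nhds hlim]
    exact hsummable.hasSum
  · intro x
    have h1 := (((hμ.tendsto_ft hD (ξ + x)).comp hL.tendsto_atTop).norm.pow 2)
    refine h1.congr' ?_
    filter_upwards [hevmem x] with i hi
    rw [if_pos hi]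
    rfl
  · have hev : ∀ᶠ i in atTop, ‖dualMap R (L i) ξ‖ ≤ δ / 2 :=
      hL.tendsto_atTop.eventually
        ((hgeo.tendsto_dualMap hr0 hr1 ξ).eventually_le_const (half_pos hδ))
    filter_upwards [hev, hL.tendsto_atTop.eventually_ge_atTop N] with i hi hiN x
    split_ifs with hx
    · have h1 := add_mem_cube ((hΛs i).2 x hx) hi
      rw [add_halves, ← map_add] at h1
      have h2 := hlow (L i) hiN _ h1
      rw [Real.norm_of_nonneg (by positivity), hfac (L i), inv_mul_eq_div, le_div_iff₀ (by positivity)]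
      gcongr
    · rw [norm_zero]
      positivity

end Sufficiency

end Moran

end

theorem mainTheorem3 (n m : ℕ) (hm : m.Prime) (hm2 : 2 < m)
    (R : ℕ → Matrix (Fin n) (Fin n) ℤ) (D : ℕ → Finset (Fin n → ℤ)) (ν : ℕ → Fin n → ℤ)
    (hR : ∀ k ≥ 1, Moran.IsExpanding (R k))
    (hRlim : limsup (fun k => ‖Moran.euclMap ((Moran.realMat (R k))⁻¹)‖ₑ) atTop < 1)
    (hDbdd : ∃ C : ℝ, ∀ k ≥ 1, ∀ d ∈ D k, ‖Moran.intVec d‖ ≤ C)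
    (hDcard : ∀ k ≥ 1, (D k).card = m)
    (hν : ∀ k ≥ 1, ∀ i, 1 ≤ ν k i ∧ ν k i ≤ (m : ℤ) - 1)
    (hzero : ∀ k ≥ 1, Moran.maskZeros (D k) = Moran.latticeCosets m (ν k))
    (hadm : ∃ δ ∈ Set.Ioo (0 : ℝ) (1 / 4), ∃ β ∈ Set.Ioo (0 : ℝ) (1 / 4), ∃ N : ℕ,
      ∀ k > N, ∀ p ≥ 1, Moran.transposeProd R k p ∈ Moran.admissible D δ β) :
    (∃ μ : Measure (EuclideanSpace ℝ (Fin n)), Moran.IsMoranMeasure R D μ) ∧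
    ∀ μ : Measure (EuclideanSpace ℝ (Fin n)), Moran.IsMoranMeasure R D μ →
      (Moran.IsSpectralMeasure μ ↔
        ∀ k ≥ 2, ∃ z : Fin n → ℤ,
          (1 / (m : ℝ)) • ((fun i => (ν k i : ℝ)) ᵥ* Moran.realMat (R k)) =
            fun i => (z i : ℝ)) := by
  obtain ⟨δ, hδ, β, hβ, N, hadm⟩ := hadm
  obtain ⟨C, hC⟩ := hDbdd
  obtain ⟨r, hr0, hr1, ⟨K, hK⟩, hgeo⟩ := Moran.exists_geomDecay hRlim
  have hdet : ∀ k ≥ 1, (Moran.realMat (R k)).det ≠ 0 := fun k hk =>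
    Moran.det_realMat_ne_zero (hR k hk)
  have hne : ∀ k ≥ 1, (D k).Nonempty := fun k hk => by
    rw [← Finset.card_pos, hDcard k hk]; exact hm.pos
  have hn : 0 < n := by
    rcases Nat.eq_zero_or_pos n with rfl | hn
    · have h1 := Finset.card_le_one_of_subsingleton (D 1)
      rw [hDcard 1 le_rfl] at h1
      omega
    · exact hn
  have hex : ∀ k, ∃ ρ : Measure (EuclideanSpace ℝ (Fin n)),
      Moran.IsMoranMeasure (fun i => R (k + i)) (fun i => D (k + i)) ρ := fun k => by
    obtain ⟨B, hB⟩ := hgeo k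
    exact Moran.exists_isMoranMeasure hr0 hr1 hB (fun j _ => hdet _ (by omega))
      (fun j _ => hC _ (by omega)) (fun j _ => hne _ (by omega))
  choose ρ' hρ' using hex
  refine ⟨⟨ρ' 0, by simpa only [zero_add] using hρ' 0⟩, fun μ hμ => ?_⟩
  have hρ : ∀ k, Moran.IsMoranMeasure (fun i => R (k + i)) (fun i => D (k + i))
      (Function.update ρ' 0 μ k) := fun k => by
    rcases Nat.eq_zero_or_pos k with rfl | hk
    · simpa only [zero_add, Function.update_self] using hμ
    · rw [Function.update_of_ne hk.ne']
      exact hρ' k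
  obtain ⟨B, hB⟩ := hgeo 0
  simp only [zero_add] at hB
  have hprob := hμ.1
  constructor
  · rintro ⟨-, -, Λ, hΛ⟩ k hk
    have h := Moran.mem_intLattice_of_isSpectralMeasure hm hn hDcard hν hzero hdet hρ
      (by rwa [Function.update_self]) (k - 2)
    rw [Nat.sub_add_cancel hk] at h
    exact (Moran.mem_intLattice_iff_vecMul _ _).1 h
  · intro hint
    refine ⟨hprob, ⟨Metric.closedBall 0 (B * C * (1 - r)⁻¹), isCompact_closedBall _ _, ?_⟩, ?_⟩
    · have h := ae_iff.1 (hμ.ae_norm_le hr0 hr1 hB hC hne)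
      rw [← h]
      congr 1
      ext x
      simp
    · obtain ⟨ε, hε, N', hlow⟩ := Moran.exists_lower_bound_ft hr0 hr1 hK hC hne hdet
        (by linarith [hδ.2]) hβ.1 hadm hρ
      exact Moran.exists_isSpectrum hm.pos hDcard hzero hdet
        (fun k hk => (Moran.mem_intLattice_iff_vecMul _ _).2 (hint k hk)) hr0 hr1 hB hδ.1 hμ hρ
        hε hlow
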